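/- Conventions. For a triangulated category $\mathcal T$ and a full subcategory $\mathcal X$ of $\mathcal T$, let $\langle\mathcal X\rangle$ be the smallest full subcategory of $\mathcal T$ containing $\mathcal X$ and closed under isomorphisms, finite direct sums, direct summands and shifts; let $\mathcal X*\mathcal Y$ consist of all objects $M$ admitting an exact triangle $X\to M\to Y\to X[1]$ with $X\in\mathcal X$, $Y\in\mathcal Y$. Put $\langle\mathcal X\rangle_0=\{0\}$, $\langle\mathcal X\rangle_1=\langle\mathcal X\rangle$ and $\langle\mathcal X\rangle_n=\langle\langle\mathcal X\rangle*\langle\mathcal X\rangle_{n-1}\rangle$ for $n\ge2$. The dimension $\dim\mathcal T$ is the infimum of the integers $d\ge-1$ such that $\mathcal T=\langle M\rangle_{d+1}$ for some object $M$ (and $\infty$ if there is none). For a commutative Noetherian ring $R$, $\mathsf{D}^{\mathrm b}(\operatorname{mod}R)$ is the bounded derived category of finitely generated $R$-modules, $\operatorname{Min}R$ is the (finite) set of minimal prime ideals of $R$, and $\lambda(R)$ is the infimum of the integers $n\ge0$ such that there is a filtration $0=I_0\subseteq I_1\subseteq\cdots\subseteq I_n=R$ by ideals with $I_i/I_{i-1}\cong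 R/\mathfrak p_i$ for some $\mathfrak p_i\in\operatorname{Spec}R$, $1\le i\le n$. Corollary. Let $k$ be a field, and let $R$ be either $k[x_1,\dots,x_r]/(m_1,\dots,m_s)$ or $k[[x_1,\dots,x_r]]/(m_1,\dots,m_s)$, where $m_1,\dots,m_s$ are monomials in $x_1,\dots,x_r$. Then $$\mathsf{D}^{\mathrm b}(\operatorname{mod}R)=\langle G\rangle_n,\qquad G=\bigoplus_{\mathfrak p\in\operatorname{Min}R}R/\mathfrak p,\qquad n=\lambda(R)\cdot\max\{\dim R/\mathfrak p+1\mid\mathfrak p\in\operatorname{Min}R\},$$ where $\dim R/\mathfrak p$ is the Krull dimension and $n$ is a (finite) non-negative integer ($n=0$ if $R=0$). In particular, $$\dim\mathsf{D}^{\mathrm b}(\operatorname{mod}R)\le\lambda(R)\cdot\max\{\dim R/\mathfrak p+1\mid\mathfrak p\in\operatorname{Min}R\}-1<\infty.$$ -/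

import Mathlib

universe w u

open CategoryTheory CategoryTheory.Limits CategoryTheory.Pretriangulated

noncomputable section

namespace TriangulatedDimension

section Generation

variable {T : Type*} [Category T] [HasZeroObject T] [HasShift T ℤ] [Preadditive T]
  [∀ n : ℤ, (shiftFunctor T n).Additive] [Pretriangulated T]

/-- `⟨P⟩`: the smallest full subcategory containing `P` which is closed under finite direct sums
(equivalently finite products, as the category is additive), direct summands and shifts.
A property stable under retracts is in particular closed under isomorphisms. -/
def shiftAddClosure (P : ObjectProperty T) : ObjectProperty T :=
  sInf {Q | P ≤ Q ∧ Q.IsClosedUnderFiniteProducts ∧ Q.IsStableUnderRetracts ∧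
    Q.IsStableUnderShift ℤ}

/-- `⟨P⟩ₙ`: the zero objects for `n = 0`, `⟨P⟩` for `n = 1`, and `⟨⟨P⟩ * ⟨P⟩ₙ₋₁⟩` for `n ≥ 2`.
Here `X * Y`, that is `ObjectProperty.extensionProduct X Y`, consists of the objects `M` that
admit a distinguished triangle `A ⟶ M ⟶ B ⟶ A⟦1⟧` with `A` in `X` and `B` in `Y`. -/
def generatedIn (P : ObjectProperty T) : ℕ → ObjectProperty T
  | 0 => fun M => IsZero M
  | 1 => shiftAddClosure P
  | n + 2 => shiftAddClosure
      (ObjectProperty.extensionProduct (shiftAddClosure P) (generatedIn P (n + 1)))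

/-- The dimension of a triangulated category: the infimum of the integers `d = n - 1` (`n : ℕ`)
such that some object `M` satisfies `⟨M⟩_{d+1} = T`, and `+∞` if there is none. -/
def triangulatedDim (T : Type*) [Category T] [HasZeroObject T] [HasShift T ℤ] [Preadditive T]
    [∀ n : ℤ, (shiftFunctor T n).Additive] [Pretriangulated T] : EReal :=
  sInf {d | ∃ (n : ℕ) (M : T), generatedIn (ObjectProperty.singleton M) n = ⊤ ∧
    d = (n : EReal) - 1}

end Generation

section Rings

variable (R : Type u) [CommRing R]

/-- `λ(R)`: the infimum of the `n` such that there is a filtration `0 = I₀ ⊆ I₁ ⊆ ⋯ ⊆ Iₙ = R`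
by ideals, each subquotient `Iᵢ₊₁ / Iᵢ` being isomorphic to `R ⧸ p` for some prime ideal `p`. -/
def primeFiltrationLength : ℕ∞ :=
  sInf {l | ∃ (n : ℕ) (I : Fin (n + 1) → Ideal R), l = n ∧ I 0 = ⊥ ∧ I (Fin.last n) = ⊤ ∧
    ∀ i : Fin n, I i.castSucc ≤ I i.succ ∧ ∃ p : PrimeSpectrum R,
      Nonempty ((I i.succ ⧸ (I i.castSucc).submoduleOf (I i.succ)) ≃ₗ[R] R ⧸ p.asIdeal)}

/-- `max {dim R/p + 1 | p ∈ Min R}`, the Krull dimensions being allowed to be infinite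
(and the maximum being `⊥` for the zero ring, which has no minimal prime). -/
def maxDimMinimalPrimes : WithBot ℕ∞ :=
  ⨆ p : minimalPrimes R, (ringKrullDim (R ⧸ (p : Ideal R)) + 1)

variable [IsNoetherianRing R]

/-- The finitely generated `R`-module `⨁_{p ∈ Min R} R/p`. -/
def minimalPrimesModule : FGModuleCat.{u} R :=
  haveI : Finite (minimalPrimes R) := (minimalPrimes.finite_of_isNoetherianRing R).to_subtype
  haveI : Module.Finite R (DirectSum (minimalPrimes R) fun p => R ⧸ (p : Ideal R)) :=
    inferInstanceAs (Module.Finite R (Π₀ p : minimalPrimes R, R ⧸ (p : Ideal R)))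
  FGModuleCat.of R (DirectSum (minimalPrimes R) fun p => R ⧸ (p : Ideal R))

/-- `D^b(mod R)`, the bounded derived category of finitely generated `R`-modules. -/
abbrev BoundedDerived [HasDerivedCategory.{w} (FGModuleCat.{u} R)] :=
  DerivedCategory.Bounded (FGModuleCat.{u} R)

/-- A finitely generated module, regarded as a complex concentrated in degree `0`,
as an object of `D^b(mod R)`. -/
def stalk [HasDerivedCategory.{w} (FGModuleCat.{u} R)] (M : FGModuleCat.{u} R) :
    BoundedDerived.{w} R :=
  ⟨(DerivedCategory.singleFunctor (FGModuleCat.{u} R) 0).obj M,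
    ⟨⟨0, inferInstance⟩, ⟨0, inferInstance⟩⟩⟩

end Rings

/-- `k[x₁,…,x_r]/(m₁,…,m_s)` where the `mⱼ` are the monomials with exponents `e j`. -/
abbrev MonomialQuotient (k : Type u) [Field k] {r s : ℕ} (e : Fin s → Fin r →₀ ℕ) : Type u :=
  MvPolynomial (Fin r) k ⧸ Ideal.span (Set.range fun j => MvPolynomial.monomial (e j) (1 : k))

/-- `k[[x₁,…,x_r]]/(m₁,…,m_s)` where the `mⱼ` are the monomials with exponents `e j`. -/
abbrev PowerSeriesMonomialQuotient (k : Type u) [Field k] {r s : ℕ}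
    (e : Fin s → Fin r →₀ ℕ) : Type u :=
  MvPowerSeries (Fin r) k ⧸ Ideal.span (Set.range fun j => MvPowerSeries.monomial (e j) (1 : k))

end TriangulatedDimension

end

open TriangulatedDimension

-- A minimal prime of a monomial ideal is generated by variables: a prime containing a monomial
-- contains one of the variables dividing it. Each component `R/p` is therefore a regular ring, and
-- its finitely generated modules have projective dimension at most `d = dim R/p`.
--
-- Let `0 = I₀ ⊆ ⋯ ⊆ Iₙ = R` be a prime filtration of minimal length. Since `R/pᵢ` is killed by
-- `pᵢ`, which contains a minimal prime `qᵢ`, one has `qᵢ Iᵢ ⊆ Iᵢ₋₁`; hence a product of `λ(R)`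
-- minimal primes is zero (`exists_primeFiltrationLength_eq`). A bounded complex `K` is cut along `K
-- ⊇ qK ⊇ q'qK ⊇ ⋯`, which reaches zero after `λ(R)` quotients, each a complex over some `R/q`
-- (`triangEnvelopeLT_of_list_prod_smul_eq_zero`).
--
-- Over `R/q` a bounded complex takes at most `d + 1` steps from `R/q`
-- (`triangEnvelopeIter_projectiveStalks`): a complex of projectives with zero differential maps
-- onto its cohomology, and the cone has the syzygies as cohomology, so that each step lowers the
-- projective dimension by one. Restriction of scalars to `R` is exact and turns `R/q` into a
-- summand of `G`. Numbers of steps add up along triangles, which gives `λ(R) · max (d + 1)`.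
--
-- The homological input is that a regular local ring of dimension `d` is a domain of global
-- dimension at most `d`, by induction on `d` modulo a regular parameter.

universe w' v

noncomputable section

namespace TriangulatedDimension

/-! ### Counting steps in triangulated categories and in their thick subcategories. -/

section Envelopes

variable {T : Type*} [Category T] [HasZeroObject T] [HasShift T ℤ] [Preadditive T]
  [∀ n : ℤ, (shiftFunctor T n).Additive] [Pretriangulated T]

omit [HasZeroObject T] [HasShift T ℤ] [Preadditive T] [∀ n : ℤ, (shiftFunctor T n).Additive]
  [Pretriangulated T] in
lemma retractClosure_isClosedUnderLimitsOfShape (P : ObjectProperty T) (J : Type*)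
    [HasLimitsOfShape (Discrete J) T] [P.IsClosedUnderLimitsOfShape (Discrete J)] :
    P.retractClosure.IsClosedUnderLimitsOfShape (Discrete J) := by
  suffices key : ∀ (F : Discrete J ⥤ T) (_ : ∀ j, P.retractClosure (F.obj j)) (c : Cone F)
      (_ : IsLimit c), P.retractClosure c.pt from
    ⟨fun X ⟨p⟩ ↦ key p.diag p.prop_diag_obj _ p.isLimit⟩
  intro F hF c hc
  choose Y hY r using hF
  replace r := fun j ↦ (r j).some
  let Z : Discrete J ⥤ T := Discrete.functor fun j ↦ Y ⟨j⟩
  have hZ : P (limit Z) := P.prop_of_isLimit (limit.isLimit Z) fun j ↦ hY ⟨j.as⟩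
  let i : F ⟶ Z := Discrete.natTrans fun j ↦ (r j).i
  let s : Z ⟶ F := Discrete.natTrans fun j ↦ (r j).r
  have his : i ≫ s = 𝟙 _ := by ext j; simp [i, s]
  refine ⟨limit Z, hZ, ⟨⟨IsLimit.map c (limit.isLimit Z) i, IsLimit.map _ hc s,
    hc.hom_ext fun j ↦ ?_⟩⟩⟩
  have h : i.app j ≫ s.app j = 𝟙 _ := congr_app his j
  have h' := IsLimit.map_π c (limit.isLimit Z) i j
  rw [Category.assoc, IsLimit.map_π, reassoc_of% h', h, Category.comp_id, Category.id_comp]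

lemma triangEnvelopeIter_zero_le {P Q : ObjectProperty T} [Q.IsClosedUnderFiniteProducts]
    [Q.IsStableUnderRetracts] [Q.IsStableUnderShift ℤ] (h : P ≤ Q) :
    P.triangEnvelopeIter 0 ≤ Q := by
  rw [ObjectProperty.triangEnvelopeIter_zero, ObjectProperty.retractClosure_le_iff,
    ObjectProperty.binaryProductsClosure_le_iff, ObjectProperty.shiftClosure_le_iff]
  exact h

/-- `triangEnvelopeIter` counts cones and `generatedIn` counts layers, whence the shift by one. This
inclusion suffices, as the goal is that everything is generated. -/
lemma triangEnvelopeIter_le_generatedIn (P : ObjectProperty T) (n : ℕ) :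
    P.triangEnvelopeIter n ≤ generatedIn P (n + 1) := by
  have h0 : P.triangEnvelopeIter 0 ≤ shiftAddClosure P :=
    le_sInf fun Q ⟨hPQ, _, _, _⟩ ↦ triangEnvelopeIter_zero_le hPQ
  induction n with
  | zero => exact h0
  | succ n ih =>
    refine le_sInf fun Q ⟨hPQ, _, _, _⟩ ↦ ?_
    rw [ObjectProperty.triangEnvelopeIter_succ, ObjectProperty.retractClosure_le_iff]
    rw [ObjectProperty.triangEnvelopeIter_zero] at h0
    exact ((ObjectProperty.monotone_extensionProduct_left _ h0).trans
      (ObjectProperty.monotone_extensionProduct_right _ ih)).trans hPQ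

/-- The first step of the envelope is an additive subcategory. -/
instance triangEnvelopeIter_zero_isClosedUnderFiniteProducts (P : ObjectProperty T)
    [P.Nonempty] : (P.triangEnvelopeIter 0).IsClosedUnderFiniteProducts := by
  have : (P.triangEnvelopeIter 0).Nonempty := .mono (P.le_triangEnvelopeIter 0)
  have : (P.triangEnvelopeIter 0).IsClosedUnderBinaryProducts := by
    rw [ObjectProperty.triangEnvelopeIter_zero]
    exact retractClosure_isClosedUnderLimitsOfShape _ _
  exact .mk'

variable {T' : Type*} [Category T'] [HasZeroObject T'] [HasShift T' ℤ] [Preadditive T']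
  [∀ n : ℤ, (shiftFunctor T' n).Additive] [Pretriangulated T']

/-- A triangulated functor preserves sums, summands, shifts and triangles, so only the generators
need checking. Applied below to restriction of scalars. -/
lemma triangEnvelopeIter_le_inverseImage (F : T ⥤ T') [F.CommShift ℤ] [F.IsTriangulated]
    (P : ObjectProperty T) (Q : ObjectProperty T') [Q.Nonempty]
    (h : P ≤ (Q.triangEnvelopeIter 0).inverseImage F) (n : ℕ) :
    P.triangEnvelopeIter n ≤ (Q.triangEnvelopeIter n).inverseImage F := by
  have hr (n : ℕ) : ((Q.triangEnvelopeIter n).inverseImage F).IsStableUnderRetracts :=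
    ⟨fun r hY ↦ (Q.triangEnvelopeIter n).prop_of_retract (r.map F) hY⟩
  have h0 : P.triangEnvelopeIter 0 ≤ (Q.triangEnvelopeIter 0).inverseImage F := by
    have : ((Q.triangEnvelopeIter 0).inverseImage F).IsClosedUnderFiniteProducts :=
      ⟨fun J _ ↦ ⟨by
        rintro X ⟨p⟩
        exact (Q.triangEnvelopeIter 0).prop_of_isLimit (isLimitOfPreserves F p.isLimit)
          p.prop_diag_obj⟩⟩
    exact triangEnvelopeIter_zero_le h
  induction n with
  | zero => exact h0
  | succ n ih =>
    have := hr (n + 1)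
    rw [ObjectProperty.triangEnvelopeIter_succ P, ObjectProperty.retractClosure_le_iff]
    rintro X ⟨Y, Z, f, g, k, hT, hY, hZ⟩
    rw [ObjectProperty.prop_inverseImage_iff, ObjectProperty.triangEnvelopeIter_succ]
    refine ObjectProperty.le_retractClosure _ _
      ⟨F.obj Y, F.obj Z, F.map f, F.map g, _, F.map_distinguished _ hT, ?_, ih _ hZ⟩
    rw [← ObjectProperty.triangEnvelopeIter_zero] at hY ⊢
    exact h0 _ hY

/-- The objects of `T` that satisfy `P` and, seen in the full subcategory, satisfy `Q`. -/
def extendProperty (P : ObjectProperty T) (Q : ObjectProperty P.FullSubcategory) :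
    ObjectProperty T :=
  fun X ↦ ∃ h : P X, Q ⟨X, h⟩

omit [HasZeroObject T] [HasShift T ℤ] [Preadditive T] [∀ n : ℤ, (shiftFunctor T n).Additive]
  [Pretriangulated T] in
lemma extendProperty_isStableUnderRetracts (P : ObjectProperty T)
    (Q : ObjectProperty P.FullSubcategory) [P.IsStableUnderRetracts] [Q.IsStableUnderRetracts] :
    (extendProperty P Q).IsStableUnderRetracts := by
  refine ⟨fun {X Y} r ⟨hY, hQ⟩ ↦ ⟨P.prop_of_retract r hY, ?_⟩⟩
  exact Q.prop_of_retract (X := ⟨X, P.prop_of_retract r hY⟩)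
    ⟨P.homMk r.i, P.homMk r.r, by ext; exact r.retract⟩ hQ

/-- Reachability in a thick subcategory can be tested in the ambient triangulated category. -/
lemma triangEnvelopeIter_fullSubcategory (P : ObjectProperty T) [P.IsTriangulated]
    [P.IsStableUnderRetracts] (G : P.FullSubcategory) (n : ℕ) :
    (ObjectProperty.singleton G.obj).triangEnvelopeIter n ≤
      extendProperty P ((ObjectProperty.singleton G).triangEnvelopeIter n) := by
  have hr (n : ℕ) := extendProperty_isStableUnderRetracts P
    ((ObjectProperty.singleton G).triangEnvelopeIter n)
  have h0 : (ObjectProperty.singleton G.obj).triangEnvelopeIter 0 ≤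
      extendProperty P ((ObjectProperty.singleton G).triangEnvelopeIter 0) := by
    have : (extendProperty P
        ((ObjectProperty.singleton G).triangEnvelopeIter 0)).IsClosedUnderFiniteProducts := by
      refine ⟨fun J _ ↦ ⟨?_⟩⟩
      rintro X ⟨p⟩
      choose h h' using p.prop_diag_obj
      have hX : P X := P.prop_of_isLimit p.isLimit h
      -- The product is formed in `T`; it lies in `P`, and the full inclusion reflects limits.
      let c : Cone (P.lift p.diag h) := ⟨⟨X, hX⟩,
        { app j := P.homMk (p.π.app j)
          naturality j k f := by ext; exact p.π.naturality f }⟩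
      have hc : IsLimit c := isLimitOfReflects P.ι p.isLimit
      exact ⟨hX, ObjectProperty.prop_of_isLimit _ hc h'⟩
    have : (extendProperty P
        ((ObjectProperty.singleton G).triangEnvelopeIter 0)).IsStableUnderShift ℤ :=
      ⟨fun a ↦ ⟨fun X ⟨hX, hX'⟩ ↦ ⟨P.le_shift a _ hX, ObjectProperty.prop_of_iso _
        (P.ι.preimageIso (X := (⟨X, hX⟩ : P.FullSubcategory)⟦a⟧) (Y := ⟨X⟦a⟧, P.le_shift a _ hX⟩)
          ((P.ι.commShiftIso a).app ⟨X, hX⟩))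
        (ObjectProperty.le_shift ((ObjectProperty.singleton G).triangEnvelopeIter 0) a _ hX')⟩⟩⟩
    refine triangEnvelopeIter_zero_le ?_
    rw [ObjectProperty.singleton_le_iff]
    exact ⟨G.property, ObjectProperty.le_triangEnvelopeIter _ _ _ (by simp)⟩
  induction n with
  | zero => exact h0
  | succ n ih =>
    have := hr (n + 1)
    rw [ObjectProperty.triangEnvelopeIter_succ (.singleton G.obj),
      ObjectProperty.retractClosure_le_iff]
    rintro X ⟨Y, Z, f, g, k, hT, hY, hZ⟩
    rw [← ObjectProperty.triangEnvelopeIter_zero] at hY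
    obtain ⟨hPY, hY⟩ := h0 _ hY
    obtain ⟨hPZ, hZ⟩ := ih _ hZ
    have hPX : P X := P.ext_of_isTriangulatedClosed₂ _ hT hPY hPZ
    refine ⟨hPX, ?_⟩
    rw [ObjectProperty.triangEnvelopeIter_succ]
    rw [ObjectProperty.triangEnvelopeIter_zero] at hY
    -- The connecting map must land in the shift of the subcategory, which agrees with that of `T`
    -- only up to this isomorphism.
    let e : (P.ι.obj ⟨Y, hPY⟩)⟦(1 : ℤ)⟧ ≅ P.ι.obj ((⟨Y, hPY⟩ : P.FullSubcategory)⟦(1 : ℤ)⟧) :=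
      ((P.ι.commShiftIso (1 : ℤ)).app ⟨Y, hPY⟩).symm
    refine ObjectProperty.le_retractClosure _ _
      ⟨⟨Y, hPY⟩, ⟨Z, hPZ⟩, P.homMk f, P.homMk g, P.homMk (k ≫ e.hom), ?_, hY, hZ⟩
    refine isomorphic_distinguished _ hT _
      (Triangle.isoMk _ _ (Iso.refl _) (Iso.refl _) (Iso.refl _) ?_ ?_ ?_)
    · change f ≫ 𝟙 _ = 𝟙 _ ≫ f
      simp
    · change g ≫ 𝟙 _ = 𝟙 _ ≫ g
      simp
    · change ((k ≫ e.hom) ≫ (P.ι.commShiftIso (1 : ℤ)).hom.app ⟨Y, hPY⟩) ≫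
        (shiftFunctor T (1 : ℤ)).map (𝟙 _) = 𝟙 _ ≫ k
      simp [e]

/-- A bounded subcategory generated in `n + 1` steps inside the ambient category. -/
lemma generatedIn_fullSubcategory_eq_top (P : ObjectProperty T) [P.IsTriangulated]
    [P.IsStableUnderRetracts] (G : P.FullSubcategory) (n : ℕ)
    (h : P ≤ (ObjectProperty.singleton G.obj).triangEnvelopeIter n) :
    generatedIn (ObjectProperty.singleton G) (n + 1) = ⊤ := by
  refine eq_top_iff.mpr fun X _ ↦ triangEnvelopeIter_le_generatedIn _ _ _ ?_
  exact (triangEnvelopeIter_fullSubcategory P G n _ (h _ X.property)).2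

lemma triangulatedDim_le {M : T} {n : ℕ}
    (h : generatedIn (ObjectProperty.singleton M) n = ⊤) :
    triangulatedDim T ≤ (n : EReal) - 1 :=
  sInf_le ⟨n, M, h, rfl⟩

lemma triangulatedDim_lt_top {M : T} {n : ℕ}
    (h : generatedIn (ObjectProperty.singleton M) n = ⊤) :
    triangulatedDim T < ⊤ := by
  refine (triangulatedDim_le h).trans_lt ?_
  rw [show ((n : EReal) - 1) = (((n : ℝ) - 1 : ℝ) : EReal) by simp]
  exact EReal.coe_lt_top _

end Envelopes

/-- Such a decomposition of the identity makes `X` a retract of `⨁ Y`, so no isomorphism with the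
biproduct is needed. -/
lemma prop_of_sum_eq_id {C : Type*} [Category C] [Preadditive C] [HasFiniteBiproducts C]
    (Q : ObjectProperty C) [Q.IsClosedUnderFiniteProducts] [Q.IsStableUnderRetracts]
    {J : Type} [Fintype J] {X : C} (Y : J → C) (π : ∀ j, X ⟶ Y j) (ι : ∀ j, Y j ⟶ X)
    (h : ∑ j, π j ≫ ι j = 𝟙 X) (hY : ∀ j, Q (Y j)) : Q X :=
  Q.prop_of_retract (Y := ⨁ Y) ⟨biproduct.lift π, biproduct.desc ι, by rw [biproduct.lift_desc, h]⟩
    (Q.prop_of_isLimit_fan (biproduct.isLimit Y) hY)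

/-! ### Building complexes from projectives in an abelian category. -/

section ProjectiveStalks

open ZeroObject

variable {A : Type u} [Category.{v} A] [Abelian A]

/-- The cochain complex with given objects and zero differential. -/
def zeroDifferential (P : ℤ → A) : CochainComplex A ℤ where
  X := P
  d _ _ := 0

lemma zeroDifferential_d (P : ℤ → A) (i j : ℤ) : (zeroDifferential P).d i j = 0 := rfl

/-- The components of a complex with zero differential. -/
def zeroDifferentialXIso (P : ℤ → A) (i : ℤ) : (zeroDifferential P).X i ≅ P i := Iso.refl _

lemma isIso_iCycles_zeroDifferential (P : ℤ → A) (i : ℤ) :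
    IsIso ((zeroDifferential P).iCycles i) :=
  (zeroDifferential P).isIso_iCycles i _ rfl rfl

lemma isIso_homologyπ_zeroDifferential (P : ℤ → A) (i : ℤ) :
    IsIso ((zeroDifferential P).homologyπ i) :=
  (zeroDifferential P).isIso_homologyπ _ i rfl rfl

/-- The homology of a complex with zero differential. -/
def homologyZeroDifferentialIso (P : ℤ → A) (i : ℤ) : (zeroDifferential P).homology i ≅ P i :=
  haveI := isIso_homologyπ_zeroDifferential P i
  (asIso ((zeroDifferential P).homologyπ i)).symm ≪≫
    (@asIso _ _ _ _ ((zeroDifferential P).iCycles i) (isIso_iCycles_zeroDifferential P i)) ≪≫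
    zeroDifferentialXIso P i

/-- Projectivity lifts `p i` to cycles; out of a zero differential, any family of maps into cycles
is a chain map. -/
lemma exists_zeroDifferential_hom (K : CochainComplex A ℤ) (P : ℤ → A) [∀ i, Projective (P i)]
    (p : ∀ i, P i ⟶ K.homology i) : ∃ φ : zeroDifferential P ⟶ K,
      ∀ i, HomologicalComplex.homologyMap φ i = (homologyZeroDifferentialIso P i).hom ≫ p i := by
  let q (i : ℤ) : P i ⟶ K.cycles i := Projective.factorThru (p i) (K.homologyπ i)
  let φ : zeroDifferential P ⟶ K :=
    { f i := (zeroDifferentialXIso P i).hom ≫ q i ≫ K.iCycles i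
      comm' i j _ := by
        rw [zeroDifferential_d, zero_comp, Category.assoc, Category.assoc, K.iCycles_d, comp_zero,
          comp_zero] }
  refine ⟨φ, fun i ↦ ?_⟩
  have := isIso_iCycles_zeroDifferential P i
  have := isIso_homologyπ_zeroDifferential P i
  rw [← cancel_epi ((zeroDifferential P).homologyπ i), HomologicalComplex.homologyπ_naturality]
  rw [homologyZeroDifferentialIso, Iso.trans_hom, Iso.symm_hom, asIso_inv, Iso.trans_hom,
    asIso_hom, Category.assoc, IsIso.hom_inv_id_assoc,
    ← Projective.factorThru_comp (p i) (K.homologyπ i), ← Category.assoc]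
  congr 1
  rw [← cancel_mono (K.iCycles i), HomologicalComplex.cyclesMap_i, Category.assoc, Category.assoc]

variable [HasDerivedCategory.{w} A]

variable (A) in
/-- The shifts of projective objects in the derived category. -/
def projectiveStalks : ObjectProperty (DerivedCategory A) :=
  fun X ↦ ∃ (P : A) (i : ℤ), Projective P ∧ X = (DerivedCategory.singleFunctor A i).obj P

instance : (projectiveStalks A).Nonempty :=
  ⟨⟨_, 0, 0, inferInstance, rfl⟩⟩

/-- With zero differential the complex is the finite direct sum of its terms in degrees `a` to `b`.
-/
lemma triangEnvelopeIter_zeroDifferential (P : ℤ → A) (hP : ∀ i, Projective (P i)) (a b : ℤ)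
    (ha : ∀ i < a, IsZero (P i)) (hb : ∀ i > b, IsZero (P i)) :
    (projectiveStalks A).triangEnvelopeIter 0 (DerivedCategory.Q.obj (zeroDifferential P)) := by
  classical
  let S (j : Finset.Icc a b) : CochainComplex A ℤ :=
    (HomologicalComplex.single A (.up ℤ) j.1).obj (P j)
  let π (j : Finset.Icc a b) : zeroDifferential P ⟶ S j :=
    HomologicalComplex.mkHomToSingle (zeroDifferentialXIso P j).hom fun _ _ ↦ by
      rw [zeroDifferential_d, zero_comp]
  let ι (j : Finset.Icc a b) : S j ⟶ zeroDifferential P :=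
    HomologicalComplex.mkHomFromSingle (zeroDifferentialXIso P j).inv fun _ _ ↦ by
      rw [zeroDifferential_d, comp_zero]
  have htot : ∑ j, π j ≫ ι j = 𝟙 _ := by
    ext i
    by_cases hi : i ∈ Finset.Icc a b
    · rw [← HomologicalComplex.Hom.fAddMonoidHom_apply, map_sum,
        Finset.sum_eq_single (⟨i, hi⟩ : Finset.Icc a b)]
      · simp only [HomologicalComplex.Hom.fAddMonoidHom_apply, HomologicalComplex.comp_f, π, ι,
          HomologicalComplex.mkHomToSingle_f, HomologicalComplex.mkHomFromSingle_f]
        rw [Category.assoc, Iso.inv_hom_id_assoc, Iso.hom_inv_id, HomologicalComplex.id_f]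
      · intro j _ hj
        rw [HomologicalComplex.Hom.fAddMonoidHom_apply, HomologicalComplex.comp_f]
        have h : i ≠ j.1 := by
          rintro rfl
          exact hj rfl
        rw [(HomologicalComplex.isZero_single_obj_X (.up ℤ) j.1 (P j) i h).eq_zero_of_tgt
          ((π j).f i), zero_comp]
      · simp
    · refine IsZero.eq_of_src ?_ _ _
      rw [Finset.mem_Icc, not_and_or, not_le, not_le] at hi
      exact hi.elim (ha i) (hb i)
  have hS (j : Finset.Icc a b) : (projectiveStalks A).triangEnvelopeIter 0
      (DerivedCategory.Q.obj (S j)) :=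
    ObjectProperty.prop_of_iso _ ((DerivedCategory.singleFunctorIsoCompQ A j.1).app (P j))
      (ObjectProperty.le_triangEnvelopeIter _ _ _ ⟨P j, j.1, hP j, rfl⟩)
  refine prop_of_sum_eq_id _ _ (fun j ↦ DerivedCategory.Q.map (π j))
    (fun j ↦ DerivedCategory.Q.map (ι j)) ?_ hS
  rw [← CategoryTheory.Functor.map_id, ← htot, Functor.map_sum]
  simp only [Functor.map_comp]

/-- A bounded complex whose homology objects have projective dimension at most `d` is built
from projective objects in `d + 1` steps. -/
theorem triangEnvelopeIter_projectiveStalks [EnoughProjectives A] (d : ℕ) (a b : ℤ)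
    (X : DerivedCategory A) [X.IsGE a] [X.IsLE b]
    (hX : ∀ i, HasProjectiveDimensionLT ((DerivedCategory.homologyFunctor A i).obj X) (d + 1)) :
    (projectiveStalks A).triangEnvelopeIter d X := by
  induction d generalizing a X with
  | zero =>
    let K := DerivedCategory.Q.objPreimage X
    let e : DerivedCategory.Q.obj K ≅ X := DerivedCategory.Q.objObjPreimageIso X
    let eh (i : ℤ) : (DerivedCategory.homologyFunctor A i).obj X ≅ K.homology i :=
      (DerivedCategory.homologyFunctor A i).mapIso e.symm ≪≫
        (DerivedCategory.homologyFunctorFactors A i).app K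
    have hproj (i : ℤ) : Projective (K.homology i) :=
      Projective.of_iso (eh i) (projective_iff_hasProjectiveDimensionLT_one.mpr (hX i))
    -- The cohomology is itself projective, so lifting the identity gives a quasi-isomorphism.
    obtain ⟨φ, hφ⟩ := exists_zeroDifferential_hom K (fun i ↦ K.homology i) fun i ↦ 𝟙 _
    have : QuasiIso φ := by
      refine ⟨fun i ↦ ?_⟩
      rw [quasiIsoAt_iff_isIso_homologyMap, hφ]
      infer_instance
    refine ObjectProperty.prop_of_iso _ (asIso (DerivedCategory.Q.map φ) ≪≫ e) ?_
    exact triangEnvelopeIter_zeroDifferential _ hproj a b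
      (fun i hi ↦ (X.isZero_of_isGE a i hi).of_iso (eh i).symm)
      (fun i hi ↦ (X.isZero_of_isLE b i hi).of_iso (eh i).symm)
  | succ d ih =>
    let K := DerivedCategory.Q.objPreimage X
    let e : DerivedCategory.Q.obj K ≅ X := DerivedCategory.Q.objObjPreimageIso X
    let eh (i : ℤ) : (DerivedCategory.homologyFunctor A i).obj X ≅ K.homology i :=
      (DerivedCategory.homologyFunctor A i).mapIso e.symm ≪≫
        (DerivedCategory.homologyFunctorFactors A i).app K
    -- Taking zero over vanishing cohomology keeps the complex of projectives bounded.
    have hP (i : ℤ) : ∃ (P : A) (p : P ⟶ K.homology i), Projective P ∧ Epi p ∧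
        (IsZero (K.homology i) → IsZero P) := by
      by_cases h : IsZero (K.homology i)
      · exact ⟨0, 0, inferInstance, h.epi _, fun _ ↦ isZero_zero A⟩
      · exact ⟨_, Projective.π _, inferInstance, inferInstance, fun h' ↦ (h h').elim⟩
    choose P p hproj hp hzero using hP
    obtain ⟨φ, hφ⟩ := exists_zeroDifferential_hom K P p
    let L := DerivedCategory.Q.obj (zeroDifferential P)
    let f : L ⟶ X := DerivedCategory.Q.map φ ≫ e.hom
    let eL (i : ℤ) : (DerivedCategory.homologyFunctor A i).obj L ≅ P i :=
      (DerivedCategory.homologyFunctorFactors A i).app _ ≪≫ homologyZeroDifferentialIso P i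
    have hPa (i : ℤ) (hi : i < a) : IsZero (P i) :=
      hzero i ((X.isZero_of_isGE a i hi).of_iso (eh i).symm)
    have hPb (i : ℤ) (hi : i > b) : IsZero (P i) :=
      hzero i ((X.isZero_of_isLE b i hi).of_iso (eh i).symm)
    have hf (i : ℤ) : Epi ((DerivedCategory.homologyFunctor A i).map f) := by
      have h1 := DerivedCategory.homologyFunctorFactors_hom_naturality φ i
      replace h1 := (Iso.eq_comp_inv ((DerivedCategory.homologyFunctorFactors A i).app K)).mpr h1
      have : Epi (HomologicalComplex.homologyMap φ i) := by
        rw [hφ]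
        exact epi_comp _ _
      rw [Functor.map_comp, h1]
      have : Epi ((DerivedCategory.homologyFunctorFactors A i).hom.app (zeroDifferential P) ≫
          HomologicalComplex.homologyMap φ i) := epi_comp' inferInstance this
      exact epi_comp' (epi_comp' this inferInstance) inferInstance
    obtain ⟨Y, g, h, hT⟩ := distinguished_cocone_triangle f
    -- As `f` is epi on cohomology, the long exact sequence splits up into `0 → Hⁱ(Y) → Hⁱ⁺¹(L) →
    -- Hⁱ⁺¹(X) → 0`: the cone carries the syzygies, one degree lower.
    have hex (i j : ℤ) (hij : i + 1 = j) : (ShortComplex.mk _ _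
        (DerivedCategory.HomologySequence.δ_comp _ hT i j hij)).ShortExact := by
      have hm : Mono (DerivedCategory.HomologySequence.δ (Triangle.mk f g h) i j hij) :=
        (DerivedCategory.HomologySequence.exact₃ _ hT i j hij).mono_g
          ((DerivedCategory.HomologySequence.epi_homologyMap_mor₁_iff _ hT i).mp (hf i))
      exact
        { exact := DerivedCategory.HomologySequence.exact₁ _ hT i j hij
          mono_f := hm
          epi_g := hf j }
    have hz (i : ℤ) (hi : IsZero (P (i + 1))) :
        IsZero ((DerivedCategory.homologyFunctor A i).obj Y) := by
      have key {B C : A} (u : B ⟶ C) (hu : Mono u) (hC : IsZero C) : IsZero B := IsZero.of_mono u hC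
      exact key _ (hex i _ rfl).mono_f (hi.of_iso (eL (i + 1)))
    have : Y.IsGE (a - 1) := (DerivedCategory.isGE_iff Y _).mpr fun i hi ↦
      hz i (hPa _ (by lia))
    have : Y.IsLE b := (DerivedCategory.isLE_iff Y _).mpr fun i hi ↦ hz i (hPb _ (by lia))
    rw [ObjectProperty.triangEnvelopeIter_succ, ← ObjectProperty.triangEnvelopeIter_zero]
    refine ObjectProperty.le_retractClosure _ _ ⟨L, Y, f, g, h, hT,
      triangEnvelopeIter_zeroDifferential P hproj a b hPa hPb, ih (a - 1) Y fun i ↦ ?_⟩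
    have hpi : Projective ((DerivedCategory.homologyFunctor A (i + 1)).obj L) :=
      Projective.of_iso (eL (i + 1)).symm (hproj _)
    have hpi' : HasProjectiveDimensionLT
        ((DerivedCategory.homologyFunctor A (i + 1)).obj L) (d + 1) :=
      hasProjectiveDimensionLT_of_ge _ 1 (d + 1) (by lia)
    exact (hex i _ rfl).hasProjectiveDimensionLT_X₁ (d + 1) hpi' (hX (i + 1))

end ProjectiveStalks

/-! ### Finitely generated modules over a Noetherian ring. -/

section FinitelyGenerated

variable {R : Type u} [CommRing R] [IsNoetherianRing R]

lemma fgModuleCat_epi_iff {M N : FGModuleCat.{u} R} (f : M ⟶ N) :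
    Epi f ↔ Function.Surjective f.hom.hom := by
  rw [← ModuleCat.epi_iff_surjective]
  exact ⟨fun _ ↦ inferInstanceAs (Epi ((forget₂ (FGModuleCat.{u} R) (ModuleCat.{u} R)).map f)),
    fun h ↦ (forget₂ (FGModuleCat.{u} R) (ModuleCat.{u} R)).epi_of_epi_map h⟩

lemma fgModuleCat_mono_iff {M N : FGModuleCat.{u} R} (f : M ⟶ N) :
    Mono f ↔ Function.Injective f.hom.hom := by
  rw [← ModuleCat.mono_iff_injective]
  exact ⟨fun _ ↦ inferInstanceAs (Mono ((forget₂ (FGModuleCat.{u} R) (ModuleCat.{u} R)).map f)),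
    fun h ↦ (forget₂ (FGModuleCat.{u} R) (ModuleCat.{u} R)).mono_of_mono_map h⟩

lemma fgModuleCat_projective (M : FGModuleCat.{u} R) [Module.Projective R M] : Projective M where
  factors {E X} f e he := by
    obtain ⟨g, hg⟩ := Module.projective_lifting_property e.hom.hom f.hom.hom
      ((fgModuleCat_epi_iff e).mp he)
    exact ⟨FGModuleCat.ofHom g, by ext1; exact hg⟩

lemma fgModuleCat_exists_free_epi (M : FGModuleCat.{u} R) :
    ∃ (n : ℕ) (f : FGModuleCat.of R (Fin n → R) ⟶ M), Epi f := by
  obtain ⟨n, f, hf⟩ := Module.Finite.exists_fin' R M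
  exact ⟨n, FGModuleCat.ofHom f, (fgModuleCat_epi_iff _).mpr hf⟩

instance : EnoughProjectives (FGModuleCat.{u} R) where
  presentation M := by
    obtain ⟨n, f, hf⟩ := fgModuleCat_exists_free_epi M
    exact ⟨{ p := FGModuleCat.of R (Fin n → R), projective := fgModuleCat_projective _, f := f }⟩

/-- Syzygies taken from finite free covers are the same in both categories. This transfers global
dimension bounds from all modules to the category defining `D^b`. -/
lemma fgModuleCat_hasProjectiveDimensionLT (M : FGModuleCat.{u} R) (d : ℕ)
    (h : HasProjectiveDimensionLT ((forget₂ (FGModuleCat.{u} R) (ModuleCat.{u} R)).obj M) (d + 1)) :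
    HasProjectiveDimensionLT M (d + 1) := by
  induction d generalizing M with
  | zero =>
    rw [zero_add, ← projective_iff_hasProjectiveDimensionLT_one] at h ⊢
    have : Module.Projective R M := (IsProjective.iff_projective (R := R) M).mpr h
    exact fgModuleCat_projective M
  | succ d ih =>
    obtain ⟨n, f, hf⟩ := fgModuleCat_exists_free_epi M
    have hS : (ShortComplex.mk (kernel.ι f) f (kernel.condition f)).ShortExact :=
      { exact := ShortComplex.exact_kernel f, mono_f := inferInstance, epi_g := hf }
    have hproj : Projective (FGModuleCat.of R (Fin n → R)) := fgModuleCat_projective _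
    have hproj' : Projective ((forget₂ (FGModuleCat.{u} R) (ModuleCat.{u} R)).obj
        (FGModuleCat.of R (Fin n → R))) :=
      (IsProjective.iff_projective (R := R) (Fin n → R)).mp inferInstance
    have hS' := hS.map_of_exact (forget₂ (FGModuleCat.{u} R) (ModuleCat.{u} R))
    exact (hS.hasProjectiveDimensionLT_X₃_iff d hproj).mpr
      (ih _ ((hS'.hasProjectiveDimensionLT_X₃_iff d hproj').mp h))

variable {S : Type u} [CommRing S] [IsNoetherianRing S]

lemma finite_restrictScalars {R S : Type u} [CommRing R] [CommRing S]
    (f : R →+* S) (hf : Function.Surjective f) (M : ModuleCat.{u} S) [Module.Finite S M] : Module.Finite R ((ModuleCat.restrictScalars f).obj M) := by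
  algebraize [f]
  let : Module R M := inferInstanceAs (Module R ((ModuleCat.restrictScalars f).obj M))
  have : IsScalarTower R S M := ⟨fun r s m ↦ mul_smul (f r) s m⟩
  have : Module.Finite R S := Module.Finite.of_surjective (Algebra.linearMap R S) hf
  exact Module.Finite.trans (R := R) S M

/-- Restriction of scalars along a surjection, for finitely generated modules. -/
def restrictFG (f : R →+* S) (hf : Function.Surjective f) :
    FGModuleCat.{u} S ⥤ FGModuleCat.{u} R :=
  (ModuleCat.isFG R).lift ((ModuleCat.isFG S).ι ⋙ ModuleCat.restrictScalars f)
    fun M ↦ finite_restrictScalars f hf M.obj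

variable (f : R →+* S) (hf : Function.Surjective f)

instance : (restrictFG f hf).Additive where
  map_add := rfl

instance : PreservesFiniteLimits (restrictFG f hf) :=
  have : PreservesFiniteLimits
      (restrictFG f hf ⋙ forget₂ (FGModuleCat.{u} R) (ModuleCat.{u} R)) :=
    inferInstanceAs (PreservesFiniteLimits
      (forget₂ (FGModuleCat.{u} S) (ModuleCat.{u} S) ⋙ ModuleCat.restrictScalars f))
  preservesFiniteLimits_of_reflects_of_preserves _
    (forget₂ (FGModuleCat.{u} R) (ModuleCat.{u} R))

instance : PreservesFiniteColimits (restrictFG f hf) :=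
  have : PreservesFiniteColimits
      (restrictFG f hf ⋙ forget₂ (FGModuleCat.{u} R) (ModuleCat.{u} R)) :=
    inferInstanceAs (PreservesFiniteColimits
      (forget₂ (FGModuleCat.{u} S) (ModuleCat.{u} S) ⋙ ModuleCat.restrictScalars f))
  preservesFiniteColimits_of_reflects_of_preserves _
    (forget₂ (FGModuleCat.{u} R) (ModuleCat.{u} R))

end FinitelyGenerated

/-! ### The bounded derived category as a thick subcategory. -/

section Bounded

variable {A : Type u} [Category.{v} A] [Abelian A] [HasDerivedCategory.{w} A]

lemma isZero_of_retract {C : Type*} [Category C] [HasZeroMorphisms C] {X Y : C} (r : Retract X Y)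
    (hY : IsZero Y) : IsZero X :=
  (IsZero.iff_id_eq_zero X).mpr (by rw [← r.retract, hY.eq_of_tgt r.i 0, zero_comp])

/-- Boundedness is read off from cohomology, and a retract of a zero object is zero. -/
instance : (DerivedCategory.TStructure.t (C := A)).bounded.IsStableUnderRetracts := by
  refine ⟨fun {X Y} r ⟨⟨a, ha⟩, ⟨b, hb⟩⟩ ↦ ⟨⟨a, ?_⟩, ⟨b, ?_⟩⟩⟩
  · have : Y.IsGE a := ha
    exact (DerivedCategory.isGE_iff X a).mpr fun i hi ↦ isZero_of_retract
      (r.map (DerivedCategory.homologyFunctor A i)) (Y.isZero_of_isGE a i hi)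
  · have : Y.IsLE b := hb
    exact (DerivedCategory.isLE_iff X b).mpr fun i hi ↦ isZero_of_retract
      (r.map (DerivedCategory.homologyFunctor A i)) (Y.isZero_of_isLE b i hi)

lemma singleFunctor_obj_of_shift (P : ObjectProperty (DerivedCategory A))
    [P.IsStableUnderShift ℤ] [P.IsClosedUnderIsomorphisms] {M : A} {i j : ℤ}
    (h : P ((DerivedCategory.singleFunctor A j).obj M)) :
    P ((DerivedCategory.singleFunctor A i).obj M) :=
  P.prop_of_iso (((DerivedCategory.singleFunctors A).shiftIso (j - i) i j (by lia)).app M)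
    (P.le_shift (j - i) _ h)

end Bounded

/-! ### Complexes over a quotient ring, seen over `R`. -/

section Restriction

variable {R S : Type u} [CommRing R] [IsNoetherianRing R] [CommRing S] [IsNoetherianRing S]
  (f : R →+* S) (hf : Function.Surjective f)

/-- A finite free module is a sum of copies of the ring. -/
lemma fgModuleCat_sum_proj_single (S : Type u) [CommRing S] (n : ℕ) :
    ∑ j : Fin n, (FGModuleCat.ofHom (LinearMap.proj j) :
        FGModuleCat.of S (Fin n → S) ⟶ FGModuleCat.of S S) ≫
      FGModuleCat.ofHom (LinearMap.single S (fun _ ↦ S) j) = 𝟙 _ := by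
  apply (forget₂ (FGModuleCat.{u} S) (ModuleCat.{u} S)).map_injective
  rw [Functor.map_sum]
  apply ModuleCat.hom_ext
  rw [ModuleCat.hom_sum]
  refine LinearMap.ext fun x ↦ ?_
  rw [LinearMap.sum_apply]
  exact LinearMap.sum_single_apply _ x

/-- A finitely generated projective is a retract of some `Sⁿ`, hence its restriction is a summand of
a sum of copies of `S`. -/
lemma restrictFG_projective (P : FGModuleCat.{u} S) [Projective P]
    (Q : ObjectProperty (FGModuleCat.{u} R)) [Q.IsClosedUnderFiniteProducts]
    [Q.IsStableUnderRetracts] (hQ : Q ((restrictFG f hf).obj (FGModuleCat.of S S))) :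
    Q ((restrictFG f hf).obj P) := by
  obtain ⟨n, p, hp⟩ := fgModuleCat_exists_free_epi P
  let r : Retract P (FGModuleCat.of S (Fin n → S)) :=
    ⟨Projective.factorThru (𝟙 P) p, p, Projective.factorThru_comp _ _⟩
  refine Q.prop_of_retract (r.map (restrictFG f hf)) ?_
  have := Abelian.hasFiniteBiproducts (C := FGModuleCat.{u} R)
  refine prop_of_sum_eq_id Q (J := Fin n) (fun _ ↦ (restrictFG f hf).obj (FGModuleCat.of S S))
    (fun j ↦ (restrictFG f hf).map (FGModuleCat.ofHom (LinearMap.proj j)))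
    (fun j ↦ (restrictFG f hf).map (FGModuleCat.ofHom (LinearMap.single S (fun _ ↦ S) j))) ?_
    fun _ ↦ hQ
  simp only [← Functor.map_comp]
  rw [← Functor.map_sum, fgModuleCat_sum_proj_single, CategoryTheory.Functor.map_id]

variable [HasDerivedCategory.{w} (FGModuleCat.{u} R)] [HasDerivedCategory.{w'} (FGModuleCat.{u} S)]

/-- A bounded complex over a quotient ring of finite global dimension `d`, seen over `R`, is
built in `d + 1` steps from any module having the quotient ring as a direct summand. -/
theorem triangEnvelopeIter_restrictFG (M : FGModuleCat.{u} R)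
    (r : Retract ((restrictFG f hf).obj (FGModuleCat.of S S)) M) (d : ℕ)
    (hd : ∀ N : FGModuleCat.{u} S,
      HasProjectiveDimensionLT ((forget₂ (FGModuleCat.{u} S) (ModuleCat.{u} S)).obj N) (d + 1))
    (a b : ℤ) (X : DerivedCategory (FGModuleCat.{u} S)) [X.IsGE a] [X.IsLE b] :
    (ObjectProperty.singleton
      ((DerivedCategory.singleFunctor (FGModuleCat.{u} R) 0).obj M)).triangEnvelopeIter d
      ((restrictFG f hf).mapDerivedCategory.obj X) := by
  refine triangEnvelopeIter_le_inverseImage (restrictFG f hf).mapDerivedCategory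
    (projectiveStalks (FGModuleCat.{u} S)) _ ?_ d X (triangEnvelopeIter_projectiveStalks d a b X
      fun i ↦ fgModuleCat_hasProjectiveDimensionLT _ _ (hd _))
  rintro _ ⟨P, i, hP, rfl⟩
  set E := (ObjectProperty.singleton
      ((DerivedCategory.singleFunctor (FGModuleCat.{u} R) 0).obj M)).triangEnvelopeIter 0
  refine E.prop_of_iso (((restrictFG f hf).mapDerivedCategorySingleFunctor i).app P).symm ?_
  refine singleFunctor_obj_of_shift E (j := 0) ?_
  -- The first step being closed under shifts, degree `0` suffices; there the question is one about
  -- modules.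
  let Q : ObjectProperty (FGModuleCat.{u} R) :=
    E.inverseImage (DerivedCategory.singleFunctor (FGModuleCat.{u} R) 0)
  have : Q.IsStableUnderRetracts :=
    ⟨fun r hY ↦ E.prop_of_retract (r.map (DerivedCategory.singleFunctor _ 0)) hY⟩
  have : Q.IsClosedUnderFiniteProducts := by
    refine ⟨fun J _ ↦ ⟨?_⟩⟩
    rintro X ⟨p⟩
    exact E.prop_of_isLimit (isLimitOfPreserves (DerivedCategory.singleFunctor _ 0) p.isLimit)
      p.prop_diag_obj
  exact restrictFG_projective f hf P Q (Q.prop_of_retract r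
    (ObjectProperty.le_triangEnvelopeIter _ _ _ (by simp)))

end Restriction

/-! ### Counting steps from zero, so that lengths add up. -/

section EnvelopeLT

variable {T : Type*} [Category T] [HasZeroObject T] [HasShift T ℤ] [Preadditive T]
  [∀ n : ℤ, (shiftFunctor T n).Additive] [Pretriangulated T]

/-- The objects built from `P` in at most `n` steps, where only zero objects are built in
`0` steps. -/
def triangEnvelopeLT (P : ObjectProperty T) : ℕ → ObjectProperty T
  | 0 => fun X ↦ IsZero X
  | n + 1 => P.triangEnvelopeIter n

variable (P : ObjectProperty T)

instance (n : ℕ) : (triangEnvelopeLT P n).IsClosedUnderIsomorphisms := by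
  cases n with
  | zero => exact ⟨fun e h ↦ IsZero.of_iso h e.symm⟩
  | succ n => exact inferInstanceAs (P.triangEnvelopeIter n).IsClosedUnderIsomorphisms

lemma triangEnvelopeLT_mono [P.Nonempty] {m n : ℕ} (h : m ≤ n) :
    triangEnvelopeLT P m ≤ triangEnvelopeLT P n := by
  cases n with
  | zero =>
    obtain rfl : m = 0 := by lia
    exact le_rfl
  | succ n =>
    cases m with
    | zero =>
      intro X hX
      obtain ⟨Z, hZ, hPZ⟩ := (P.triangEnvelopeIter 0).exists_prop_of_containsZero
      exact P.monotone'_triangEnvelopeIter (Nat.zero_le n) _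
        (ObjectProperty.prop_of_iso _ (hZ.iso hX) hPZ)
    | succ m => exact P.monotone'_triangEnvelopeIter (by lia)

/-- If an outer term is zero, the middle term is isomorphic to the other one; otherwise this is the
additivity of `triangEnvelopeIter`. -/
lemma triangEnvelopeLT_add [IsTriangulated T] {X Y Z : T} {f : X ⟶ Y} {g : Y ⟶ Z}
    {h : Z ⟶ X⟦(1 : ℤ)⟧} (hT : Triangle.mk f g h ∈ distTriang T) {m n : ℕ}
    (hX : triangEnvelopeLT P m X) (hZ : triangEnvelopeLT P n Z) :
    triangEnvelopeLT P (m + n) Y := by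
  cases m with
  | zero =>
    rw [zero_add]
    have : IsIso g := (Triangle.isZero₁_iff_isIso₂ _ hT).mp hX
    exact ObjectProperty.prop_of_iso _ (asIso g).symm hZ
  | succ m =>
    cases n with
    | zero =>
      have : IsIso f := (Triangle.isZero₃_iff_isIso₁ _ hT).mp hZ
      exact ObjectProperty.prop_of_iso _ (asIso f) hX
    | succ n =>
      change P.triangEnvelopeIter (m + 1 + n) Y
      rw [P.triangEnvelopeIter_add (n := m + 1) (m := n) (n' := m) rfl]
      exact ObjectProperty.le_retractClosure _ _ ⟨X, Z, f, g, h, hT, hX, hZ⟩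

lemma generatedIn_fullSubcategory_eq_top_of_le (Q : ObjectProperty T) [Q.IsTriangulated]
    [Q.IsStableUnderRetracts] (G : Q.FullSubcategory) (n : ℕ)
    (h : Q ≤ triangEnvelopeLT (ObjectProperty.singleton G.obj) n) :
    generatedIn (ObjectProperty.singleton G) n = ⊤ := by
  cases n with
  | zero =>
    refine eq_top_iff.mpr fun X _ ↦ ?_
    change IsZero X
    have hX : IsZero X.obj := h _ X.property
    rw [IsZero.iff_id_eq_zero]
    ext
    exact hX.eq_of_src _ _
  | succ n => exact generatedIn_fullSubcategory_eq_top Q G n h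

end EnvelopeLT

/-! ### Reduction of modules and complexes modulo an ideal. -/

section QuotientFunctor

variable {R : Type u} [CommRing R] (q : Ideal R)

section

variable {M N L : Type*} [AddCommGroup M] [Module R M] [AddCommGroup N] [Module R N]
  [AddCommGroup L] [Module R L]

/-- The map `M / qM → N / qN` induced by a linear map, as a linear map over `R / q`. -/
def quotientMap (f : M →ₗ[R] N) :
    (M ⧸ (q • ⊤ : Submodule R M)) →ₗ[R ⧸ q] (N ⧸ (q • ⊤ : Submodule R N)) where
  toFun := Submodule.mapQ (q • ⊤) (q • ⊤) f (Submodule.smul_top_le_comap_smul_top q f)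
  map_add' := map_add _
  map_smul' r x := by
    obtain ⟨r, rfl⟩ := Ideal.Quotient.mk_surjective r
    obtain ⟨x, rfl⟩ := Submodule.Quotient.mk_surjective _ x
    exact congrArg (Submodule.Quotient.mk (p := (q • ⊤ : Submodule R N))) (f.map_smul r x)

lemma quotientMap_id : quotientMap q (LinearMap.id : M →ₗ[R] M) = LinearMap.id := by
  refine LinearMap.ext fun x ↦ ?_
  obtain ⟨x, rfl⟩ := Submodule.Quotient.mk_surjective _ x
  rfl

lemma quotientMap_comp (g : N →ₗ[R] L) (f : M →ₗ[R] N) :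
    quotientMap q (g ∘ₗ f) = quotientMap q g ∘ₗ quotientMap q f := by
  refine LinearMap.ext fun x ↦ ?_
  obtain ⟨x, rfl⟩ := Submodule.Quotient.mk_surjective _ x
  rfl

lemma quotientMap_add (f g : M →ₗ[R] N) :
    quotientMap q (f + g) = quotientMap q f + quotientMap q g := by
  refine LinearMap.ext fun x ↦ ?_
  obtain ⟨x, rfl⟩ := Submodule.Quotient.mk_surjective _ x
  rfl

instance finite_quotient_smul_top [Module.Finite R M] :
    Module.Finite (R ⧸ q) (M ⧸ (q • ⊤ : Submodule R M)) :=
  Module.Finite.of_restrictScalars_finite R _ _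

end

/-- Reduction modulo an ideal `q`, the functor `M ↦ M / qM`. -/
def quotientFG : FGModuleCat.{u} R ⥤ FGModuleCat.{u} (R ⧸ q) where
  obj M := FGModuleCat.of (R ⧸ q) (M ⧸ (q • ⊤ : Submodule R M))
  map f := FGModuleCat.ofHom (quotientMap q f.hom.hom)
  map_id _ := FGModuleCat.hom_ext (quotientMap_id q)
  map_comp f g := FGModuleCat.hom_ext (quotientMap_comp q g.hom.hom f.hom.hom)

instance : (quotientFG q).Additive where
  map_add {_ _ f g} := FGModuleCat.hom_ext (quotientMap_add q f.hom.hom g.hom.hom)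

/-- The natural projection `M ⟶ M / qM`. -/
def quotientFGπ : 𝟭 (FGModuleCat.{u} R) ⟶
    quotientFG q ⋙ restrictFG (Ideal.Quotient.mk q) Ideal.Quotient.mk_surjective where
  app M := ObjectProperty.homMk (ModuleCat.ofHom (X := M)
    (Y := (ModuleCat.restrictScalars (Ideal.Quotient.mk q)).obj ((quotientFG q).obj M).obj)
    { toFun := Submodule.Quotient.mk (p := (q • ⊤ : Submodule R M))
      map_add' _ _ := rfl
      map_smul' _ _ := rfl })
  naturality _ _ _ := rfl

lemma quotientFGπ_app_apply (M : FGModuleCat.{u} R) (m : M) :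
    ((quotientFGπ q).app M).hom.hom m = Submodule.Quotient.mk (p := (q • ⊤ : Submodule R M)) m :=
  rfl

variable [IsNoetherianRing R]

instance (M : FGModuleCat.{u} R) : Epi ((quotientFGπ q).app M) :=
  (fgModuleCat_epi_iff _).mpr (Submodule.Quotient.mk_surjective _)

/-- The natural projection `K ⟶ K / qK` of complexes. -/
def quotientComplexπ (K : CochainComplex (FGModuleCat.{u} R) ℤ) :
    K ⟶ ((restrictFG (Ideal.Quotient.mk q) Ideal.Quotient.mk_surjective).mapHomologicalComplex
      (.up ℤ)).obj (((quotientFG q).mapHomologicalComplex (.up ℤ)).obj K) where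
  f i := (quotientFGπ q).app (K.X i)
  comm' i j _ := ((quotientFGπ q).naturality (K.d i j)).symm

instance (K : CochainComplex (FGModuleCat.{u} R) ℤ) : Epi (quotientComplexπ q K) :=
  HomologicalComplex.epi_of_epi_f _ fun i ↦ inferInstanceAs (Epi ((quotientFGπ q).app (K.X i)))

/-- The kernel is `qK` in each degree, and `J(qK) = (Jq)K`. -/
lemma smul_kernel_quotientComplexπ (K : CochainComplex (FGModuleCat.{u} R) ℤ) (J : Ideal R)
    (i : ℤ) (hK : ∀ r ∈ J * q, ∀ m : K.X i, r • m = 0) (r : R) (hr : r ∈ J)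
    (y : (kernel (quotientComplexπ q K)).X i) : r • y = 0 := by
  have hm : Mono ((kernel.ι (quotientComplexπ q K)).f i) := inferInstance
  have hinj := (fgModuleCat_mono_iff _).mp hm
  apply hinj
  rw [map_smul, map_zero]
  set m := ((kernel.ι (quotientComplexπ q K)).f i).hom.hom y with hmdef
  have h0 : ((quotientFGπ q).app (K.X i)).hom.hom m = 0 := by
    have h1 : (kernel.ι (quotientComplexπ q K)).f i ≫ (quotientFGπ q).app (K.X i) = 0 := by
      have := HomologicalComplex.congr_hom (kernel.condition (quotientComplexπ q K)) i
      exact this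
    have := congrArg (fun g ↦ g.hom.hom y) h1
    exact this
  rw [quotientFGπ_app_apply] at h0
  have h2 : m ∈ (q • ⊤ : Submodule R (K.X i)) := (Submodule.Quotient.mk_eq_zero _).mp h0
  refine Submodule.smul_induction_on (p := fun x ↦ r • x = 0) h2 (fun s hs x _ ↦ ?_)
    fun x y hx hy ↦ ?_
  · rw [← mul_smul]
    exact hK _ (Ideal.mul_mem_mul hr hs) x
  · rw [smul_add, hx, hy, add_zero]

end QuotientFunctor

/-! ### Dévissage along a product of ideals. -/

section Devissage

variable {R : Type u} [CommRing R] [IsNoetherianRing R]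
  [HasDerivedCategory.{w} (FGModuleCat.{u} R)]

/-- Dévissage of a bounded complex killed by a product of ideals whose quotient rings have
finite global dimension. -/
theorem triangEnvelopeLT_of_list_prod_smul_eq_zero (M : FGModuleCat.{u} R) (m : ℕ) (a b : ℤ)
    (l : List (Ideal R))
    (hl : ∀ q ∈ l, Nonempty (Retract ((restrictFG (Ideal.Quotient.mk q)
        Ideal.Quotient.mk_surjective).obj (FGModuleCat.of (R ⧸ q) (R ⧸ q))) M) ∧
      ∃ d : ℕ, d + 1 ≤ m ∧ ∀ N : FGModuleCat.{u} (R ⧸ q), HasProjectiveDimensionLT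
        ((forget₂ (FGModuleCat.{u} (R ⧸ q)) (ModuleCat.{u} (R ⧸ q))).obj N) (d + 1))
    (K : CochainComplex (FGModuleCat.{u} R) ℤ) [K.IsStrictlyGE a] [K.IsStrictlyLE b]
    (hK : ∀ i, ∀ r ∈ l.prod, ∀ x : K.X i, r • x = 0) :
    triangEnvelopeLT (ObjectProperty.singleton
      ((DerivedCategory.singleFunctor (FGModuleCat.{u} R) 0).obj M)) (l.length * m)
      (DerivedCategory.Q.obj K) := by
  induction l generalizing K with
  | nil =>
    rw [List.length_nil, zero_mul]
    -- The empty product is the unit ideal, so `1` kills `K`.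
    have hz : IsZero K := by
      rw [IsZero.iff_id_eq_zero]
      ext i x
      have := hK i 1 (by simp) x
      rw [one_smul] at this
      exact this
    exact Functor.map_isZero DerivedCategory.Q hz
  | cons q l ih =>
    obtain ⟨⟨r⟩, d, hdm, hd⟩ := hl q (by simp)
    let F := restrictFG (Ideal.Quotient.mk q) Ideal.Quotient.mk_surjective
    let L : CochainComplex (FGModuleCat.{u} (R ⧸ q)) ℤ :=
      ((quotientFG q).mapHomologicalComplex (.up ℤ)).obj K
    let π := quotientComplexπ q K
    have hGE : (kernel π).IsStrictlyGE a := (CochainComplex.isStrictlyGE_iff _ _).mpr fun i hi ↦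
      IsZero.of_mono ((kernel.ι π).f i) (K.isZero_of_isStrictlyGE a i hi)
    have hLE : (kernel π).IsStrictlyLE b := (CochainComplex.isStrictlyLE_iff _ _).mpr fun i hi ↦
      IsZero.of_mono ((kernel.ι π).f i) (K.isZero_of_isStrictlyLE b i hi)
    have hLGE : L.IsStrictlyGE a := (CochainComplex.isStrictlyGE_iff _ _).mpr fun i hi ↦
      (quotientFG q).map_isZero (K.isZero_of_isStrictlyGE a i hi)
    have hLLE : L.IsStrictlyLE b := (CochainComplex.isStrictlyLE_iff _ _).mpr fun i hi ↦
      (quotientFG q).map_isZero (K.isZero_of_isStrictlyLE b i hi)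
    have hY := ih (fun p hp ↦ hl p (by simp [hp])) (kernel π) fun i s hs y ↦
      smul_kernel_quotientComplexπ q K l.prod i (by
        rw [mul_comm, ← List.prod_cons]
        exact hK i) s hs y
    have hS : (ShortComplex.mk (kernel.ι π) π (kernel.condition π)).ShortExact :=
      { exact := ShortComplex.exact_kernel π
        mono_f := inferInstance
        epi_g := inferInstanceAs (Epi (quotientComplexπ q K)) }
    -- The derived category of `R/q` is only auxiliary, so any model of it will do.
    let : HasDerivedCategory.{u + 1} (FGModuleCat.{u} (R ⧸ q)) := .standard _
    have hq : (ObjectProperty.singleton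
        ((DerivedCategory.singleFunctor (FGModuleCat.{u} R) 0).obj M)).triangEnvelopeIter d
        (DerivedCategory.Q.obj ((F.mapHomologicalComplex (.up ℤ)).obj L)) :=
      ObjectProperty.prop_of_iso _ (F.mapDerivedCategoryFactors.app L)
        (triangEnvelopeIter_restrictFG _ _ M r d hd a b (DerivedCategory.Q.obj L))
    have hq' := triangEnvelopeLT_mono (ObjectProperty.singleton
        ((DerivedCategory.singleFunctor (FGModuleCat.{u} R) 0).obj M)) hdm _ hq
    rw [List.length_cons, add_mul, one_mul]
    exact triangEnvelopeLT_add _ (DerivedCategory.triangleOfSES_distinguished hS) hY hq'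

end Devissage

/-! ### From prime filtrations to vanishing products of minimal primes. -/

section PrimeFiltration

variable (R : Type u) [CommRing R]

lemma mul_le_of_quotient_equiv {I J p : Ideal R}
    (e : (J ⧸ I.submoduleOf J) ≃ₗ[R] R ⧸ p) : p * J ≤ I := by
  refine Ideal.mul_le.mpr fun r hr x hx ↦ ?_
  have h : r • (Submodule.Quotient.mk ⟨x, hx⟩ : J ⧸ I.submoduleOf J) = 0 := by
    apply e.injective
    rw [map_smul, map_zero]
    obtain ⟨y, hy⟩ := Ideal.Quotient.mk_surjective (e (Submodule.Quotient.mk ⟨x, hx⟩))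
    rw [← hy, ← Ideal.Quotient.mk_eq_mk, ← Submodule.Quotient.mk_smul,
      Submodule.Quotient.mk_eq_zero]
    exact p.mul_mem_right y hr
  rw [← Submodule.Quotient.mk_smul, Submodule.Quotient.mk_eq_zero] at h
  exact h

/-- Each `p` of the filtration is replaced by a minimal prime `q ≤ p`; this only shrinks `p * I
j.succ`, which already lies in `I j.castSucc`. -/
lemma exists_list_minimalPrimes_mul_le {n : ℕ} (I : Fin (n + 1) → Ideal R) (h0 : I 0 = ⊥)
    (h : ∀ i : Fin n, ∃ p : PrimeSpectrum R,
      Nonempty ((I i.succ ⧸ (I i.castSucc).submoduleOf (I i.succ)) ≃ₗ[R] R ⧸ p.asIdeal))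
    (j : Fin (n + 1)) : ∃ l : List (Ideal R), l.length = j ∧ (∀ q ∈ l, q ∈ minimalPrimes R) ∧
      l.prod * I j = ⊥ := by
  induction j using Fin.induction with
  | zero => exact ⟨[], rfl, by simp, by simp [h0]⟩
  | succ j ih =>
    obtain ⟨l, hl, hlq, hlI⟩ := ih
    obtain ⟨p, ⟨e⟩⟩ := h j
    obtain ⟨q, hq, hqp⟩ := Ideal.exists_minimalPrimes_le (I := (⊥ : Ideal R)) (J := p.asIdeal) bot_le
    refine ⟨q :: l, by simp [hl], by simpa using ⟨hq, hlq⟩, ?_⟩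
    rw [List.prod_cons, mul_comm q, mul_assoc, eq_bot_iff, ← hlI]
    exact Ideal.mul_mono_right ((Ideal.mul_mono_left hqp).trans (mul_le_of_quotient_equiv R e))

variable [IsNoetherianRing R]

/-- A Noetherian ring has a prime filtration, so the infimum is finite and attained. -/
lemma exists_primeFiltrationLength_eq : ∃ (n : ℕ) (l : List (Ideal R)),
    primeFiltrationLength R = n ∧ l.length = n ∧ (∀ q ∈ l, q ∈ minimalPrimes R) ∧ l.prod = ⊥ := by
  have hne : {l : ℕ∞ | ∃ (n : ℕ) (I : Fin (n + 1) → Ideal R), l = n ∧ I 0 = ⊥ ∧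
      I (Fin.last n) = ⊤ ∧ ∀ i : Fin n, I i.castSucc ≤ I i.succ ∧ ∃ p : PrimeSpectrum R,
        Nonempty ((I i.succ ⧸ (I i.castSucc).submoduleOf (I i.succ)) ≃ₗ[R]
          R ⧸ p.asIdeal)}.Nonempty := by
    obtain ⟨s, hs, hs'⟩ := IsNoetherianRing.exists_relSeries_isQuotientEquivQuotientPrime R R
    exact ⟨_, s.length, s.toFun, rfl, hs, hs', s.step⟩
  obtain ⟨n, I, hn, h0, hlast, hI⟩ := csInf_mem hne
  obtain ⟨l, hl, hlq, hlI⟩ := exists_list_minimalPrimes_mul_le R I h0 (fun i ↦ (hI i).2) (Fin.last n)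
  refine ⟨n, l, hn, by simpa using hl, hlq, ?_⟩
  rwa [hlast, Ideal.mul_top] at hlI

end PrimeFiltration

/-! ### The generation theorem for rings with regular components. -/

section Main

variable {R : Type u} [CommRing R] [IsNoetherianRing R]

lemma exists_retract_minimalPrimesModule {q : Ideal R} (hq : q ∈ minimalPrimes R) :
    Nonempty (Retract ((restrictFG (Ideal.Quotient.mk q)
        Ideal.Quotient.mk_surjective).obj (FGModuleCat.of (R ⧸ q) (R ⧸ q)))
      (minimalPrimesModule R)) := by
  classical
  have : Finite (minimalPrimes R) := (minimalPrimes.finite_of_isNoetherianRing R).to_subtype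
  have : Module.Finite R (DirectSum (minimalPrimes R) fun p => R ⧸ (p : Ideal R)) :=
    inferInstanceAs (Module.Finite R (Π₀ p : minimalPrimes R, R ⧸ (p : Ideal R)))
  let F := restrictFG (Ideal.Quotient.mk q) Ideal.Quotient.mk_surjective
  let N : ModuleCat.{u} R := (ModuleCat.restrictScalars (Ideal.Quotient.mk q)).obj
    (FGModuleCat.of (R ⧸ q) (R ⧸ q)).obj
  -- The same `R`-module in two guises: restricted from `R/q`, and as a quotient of `R`.
  let r' : Retract (F.obj (FGModuleCat.of (R ⧸ q) (R ⧸ q))) (FGModuleCat.of R (R ⧸ q)) :=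
    { i := ObjectProperty.homMk (ModuleCat.ofHom (X := N) (Y := R ⧸ q)
        { toFun := fun x ↦ x
          map_add' _ _ := rfl
          map_smul' _ _ := rfl })
      r := ObjectProperty.homMk (ModuleCat.ofHom (X := R ⧸ q) (Y := N)
        { toFun := fun x ↦ x
          map_add' _ _ := rfl
          map_smul' _ _ := rfl })
      retract := rfl }
  have h : DirectSum.component R (minimalPrimes R) (fun p ↦ R ⧸ (p : Ideal R)) ⟨q, hq⟩ ∘ₗ
      DirectSum.lof R (minimalPrimes R) (fun p ↦ R ⧸ (p : Ideal R)) ⟨q, hq⟩ = LinearMap.id :=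
    LinearMap.ext fun x ↦ DirectSum.component.lof_self
      (M := fun p : minimalPrimes R ↦ R ⧸ (p : Ideal R)) R ⟨q, hq⟩ x
  let r : Retract (FGModuleCat.of R (R ⧸ q))
      (FGModuleCat.of R (DirectSum (minimalPrimes R) fun p ↦ R ⧸ (p : Ideal R))) :=
    { i := FGModuleCat.ofHom (DirectSum.lof R (minimalPrimes R)
        (fun p ↦ R ⧸ (p : Ideal R)) ⟨q, hq⟩)
      r := FGModuleCat.ofHom (DirectSum.component R (minimalPrimes R)
        (fun p ↦ R ⧸ (p : Ideal R)) ⟨q, hq⟩)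
      retract := FGModuleCat.hom_ext h }
  exact ⟨r'.trans r⟩

lemma exists_maxDimMinimalPrimes_eq (d : minimalPrimes R → ℕ)
    (hd : ∀ p : minimalPrimes R, ringKrullDim (R ⧸ (p : Ideal R)) = d p) :
    ∃ m : ℕ, (∀ p, d p + 1 ≤ m) ∧ ∀ n : ℕ, (n : ℕ∞) = primeFiltrationLength R →
      ((n * m : ℕ) : WithBot ℕ∞) =
        (primeFiltrationLength R : WithBot ℕ∞) * maxDimMinimalPrimes R := by
  have : Finite (minimalPrimes R) := (minimalPrimes.finite_of_isNoetherianRing R).to_subtype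
  cases isEmpty_or_nonempty (minimalPrimes R) with
  | inl h =>
    -- Without minimal primes the maximum is `⊥`, but `λ(R) = 0` makes the product `0`.
    refine ⟨0, fun p ↦ (h.false p).elim, fun n hn ↦ ?_⟩
    obtain ⟨n', l, hn', hl, hlq, -⟩ := exists_primeFiltrationLength_eq R
    have hl0 : l = [] := List.eq_nil_iff_forall_not_mem.mpr fun q hq ↦ h.false ⟨q, hlq q hq⟩
    have h0 : primeFiltrationLength R = 0 := by
      rw [hn', ← hl, hl0]
      rfl
    rw [h0]
    simp
  | inr h =>
    obtain ⟨p₀, hp₀⟩ := Finite.exists_max d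
    refine ⟨d p₀ + 1, fun p ↦ by simpa using hp₀ p, fun n hn ↦ ?_⟩
    have hmax : maxDimMinimalPrimes R = ((d p₀ + 1 : ℕ) : WithBot ℕ∞) := by
      refine le_antisymm (iSup_le fun p ↦ ?_) ?_
      · rw [hd p]
        exact_mod_cast Nat.add_le_add_right (hp₀ p) 1
      · refine le_trans (le_of_eq ?_) (le_iSup _ p₀)
        rw [hd p₀]
        norm_cast
    rw [hmax, ← hn]
    push_cast
    rfl

variable [HasDerivedCategory.{w} (FGModuleCat.{u} R)]

variable (R) in
/-- The generation theorem for rings all of whose irreducible components have finite global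
dimension equal to their Krull dimension. -/
theorem generatedIn_stalk_minimalPrimesModule (h : ∀ p ∈ minimalPrimes R, ∃ d : ℕ,
      ringKrullDim (R ⧸ p) = d ∧ ∀ N : FGModuleCat.{u} (R ⧸ p), HasProjectiveDimensionLT
        ((forget₂ (FGModuleCat.{u} (R ⧸ p)) (ModuleCat.{u} (R ⧸ p))).obj N) (d + 1)) :
    ∃ n : ℕ, (n : WithBot ℕ∞) =
        (primeFiltrationLength R : WithBot ℕ∞) * maxDimMinimalPrimes R ∧
      generatedIn (ObjectProperty.singleton (stalk.{w} R (minimalPrimesModule R))) n = ⊤ ∧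
      triangulatedDim (BoundedDerived.{w} R) ≤ (n : EReal) - 1 ∧
      triangulatedDim (BoundedDerived.{w} R) < ⊤ := by
  choose d hd hpd using fun p : minimalPrimes R ↦ h p p.2
  obtain ⟨m, hm, hmax⟩ := exists_maxDimMinimalPrimes_eq d hd
  obtain ⟨n, l, hn, hl, hlq, hprod⟩ := exists_primeFiltrationLength_eq R
  have hgen : generatedIn (ObjectProperty.singleton (stalk.{w} R (minimalPrimesModule R)))
      (n * m) = ⊤ := by
    refine generatedIn_fullSubcategory_eq_top_of_le _ _ _ ?_
    rintro X ⟨⟨a, ha⟩, ⟨b, hb⟩⟩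
    have : X.IsGE a := ha
    have : X.IsLE b := hb
    obtain ⟨K, _, _, ⟨e⟩⟩ := X.exists_iso_Q_obj_of_isGE_of_isLE a b
    refine ObjectProperty.prop_of_iso _ e.symm ?_
    rw [← hl]
    refine triangEnvelopeLT_of_list_prod_smul_eq_zero (minimalPrimesModule R) m a b l
      (fun q hq ↦ ⟨exists_retract_minimalPrimesModule (hlq q hq), d ⟨q, hlq q hq⟩, hm ⟨q, hlq q hq⟩,
        hpd ⟨q, hlq q hq⟩⟩)
      K fun i r hr x ↦ ?_
    rw [hprod, Ideal.mem_bot] at hr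
    rw [hr, zero_smul]
  exact ⟨n * m, hmax n hn.symm, hgen, triangulatedDim_le hgen, triangulatedDim_lt_top hgen⟩

end Main

/-! ### Projective dimension and quotients by a regular element. -/

section ChangeOfRings

variable {S : Type u} [CommRing S] (x : S)

lemma shortExact_of_linearMap {M N P : Type u} [AddCommGroup M] [Module S M] [AddCommGroup N]
    [Module S N] [AddCommGroup P] [Module S P] {f : M →ₗ[S] N} {g : N →ₗ[S] P}
    (hf : Function.Injective f) (hg : Function.Surjective g) (h : Function.Exact f g) :
    (ShortComplex.mk (ModuleCat.ofHom f) (ModuleCat.ofHom g)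
      (ModuleCat.hom_ext h.linearMap_comp_eq_zero)).ShortExact where
  exact := (ShortComplex.ShortExact.moduleCat_exact_iff_function_exact _).mpr h
  mono_f := (ModuleCat.mono_iff_injective _).mpr hf
  epi_g := (ModuleCat.epi_iff_surjective _).mpr hg

/-- Multiplication by `x` on the free module is a resolution of length one. The index set is
arbitrary, to cover all projectives over `S/x`. -/
lemma hasProjectiveDimensionLT_finsupp_quotient (hx : x ∈ nonZeroDivisors S) (ι : Type u) :
    HasProjectiveDimensionLT (ModuleCat.of S (ι →₀ S ⧸ Ideal.span {x})) 2 := by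
  have h := shortExact_of_linearMap (f := x • (LinearMap.id : (ι →₀ S) →ₗ[S] (ι →₀ S)))
    (g := Finsupp.mapRange.linearMap (Submodule.mkQ (Ideal.span {x}))) ?_ ?_ ?_
  · have hP : Projective (ModuleCat.of S (ι →₀ S)) :=
      (IsProjective.iff_projective (R := S) (ι →₀ S)).mp inferInstance
    exact h.hasProjectiveDimensionLT_X₃ 1 (projective_iff_hasProjectiveDimensionLT_one.mp hP)
      (hasProjectiveDimensionLT_of_ge _ 1 2 (by lia))
  · intro v w hvw
    ext i
    have := DFunLike.congr_fun hvw i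
    exact (mul_cancel_left_mem_nonZeroDivisors hx).mp this
  · exact Finsupp.mapRange_surjective _ (map_zero _) (Submodule.mkQ_surjective _)
  · intro v
    constructor
    · intro hv
      have hv' (i : ι) : ∃ s, x * s = v i := by
        have := DFunLike.congr_fun hv i
        obtain ⟨s, hs⟩ := Ideal.mem_span_singleton'.mp
          ((Submodule.Quotient.mk_eq_zero (Ideal.span {x})).mp this)
        exact ⟨s, by rw [mul_comm, hs]⟩
      choose s hs using hv'
      refine ⟨Finsupp.onFinset v.support s fun i hi ↦ ?_, ?_⟩
      · rw [Finsupp.mem_support_iff, ← hs i]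
        intro h0
        refine hi ((mul_cancel_left_mem_nonZeroDivisors hx).mp ?_)
        rw [h0, mul_zero]
      · ext i
        exact hs i
    · rintro ⟨v, rfl⟩
      ext i
      exact (Submodule.Quotient.mk_eq_zero (Ideal.span {x})).mpr
        (Ideal.mul_mem_right _ _ (Ideal.mem_span_singleton_self x))

/-- Change of rings: projective dimension goes up by at most one along `S ⟶ S / x`. -/
lemma hasProjectiveDimensionLT_of_quotient (hx : x ∈ nonZeroDivisors S) (e : ℕ) (L : Type u)
    [AddCommGroup L] [Module S L] [Module (S ⧸ Ideal.span {x}) L]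
    [IsScalarTower S (S ⧸ Ideal.span {x}) L]
    (h : HasProjectiveDimensionLT (ModuleCat.of (S ⧸ Ideal.span {x}) L) (e + 1)) :
    HasProjectiveDimensionLT (ModuleCat.of S L) (e + 2) := by
  induction e generalizing L with
  | zero =>
    rw [zero_add, ← projective_iff_hasProjectiveDimensionLT_one] at h
    have : Module.Projective (S ⧸ Ideal.span {x}) L :=
      (IsProjective.iff_projective (R := S ⧸ Ideal.span {x}) L).mpr h
    obtain ⟨s, hs⟩ := Module.projective_def'.mp this
    let r : Retract (ModuleCat.of S L) (ModuleCat.of S (L →₀ S ⧸ Ideal.span {x})) :=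
      { i := ModuleCat.ofHom (s.restrictScalars S)
        r := ModuleCat.ofHom ((Finsupp.linearCombination (S ⧸ Ideal.span {x}) id).restrictScalars S)
        retract := ModuleCat.hom_ext (LinearMap.ext fun y ↦ LinearMap.congr_fun hs y) }
    have := hasProjectiveDimensionLT_finsupp_quotient x hx L
    exact r.hasProjectiveDimensionLT 2
  | succ e ih =>
    let g : (L →₀ S ⧸ Ideal.span {x}) →ₗ[S ⧸ Ideal.span {x}] L :=
      Finsupp.linearCombination (S ⧸ Ideal.span {x}) id
    have hg : Function.Surjective g := Finsupp.linearCombination_id_surjective _ L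
    have h1 := shortExact_of_linearMap (S := S ⧸ Ideal.span {x}) (M := g.ker) (f := g.ker.subtype)
      (g := g) Subtype.val_injective hg (LinearMap.exact_subtype_ker_map g)
    let i : g.ker →ₗ[S] (L →₀ S ⧸ Ideal.span {x}) := g.ker.subtype.restrictScalars S
    have hi : Function.Injective i := Subtype.val_injective
    have hex : Function.Exact i (g.restrictScalars S) :=
      fun y ↦ LinearMap.exact_subtype_ker_map g y
    have hg' : Function.Surjective (g.restrictScalars S) := hg
    have h2 := shortExact_of_linearMap (M := g.ker) hi hg' hex
    have hP : Projective (ModuleCat.of (S ⧸ Ideal.span {x}) (L →₀ S ⧸ Ideal.span {x})) :=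
      (IsProjective.iff_projective (R := S ⧸ Ideal.span {x}) (L →₀ S ⧸ Ideal.span {x})).mp
        inferInstance
    have h3 := ih g.ker ((h1.hasProjectiveDimensionLT_X₃_iff e hP).mp h)
    have h4 := hasProjectiveDimensionLT_finsupp_quotient x hx L
    exact h2.hasProjectiveDimensionLT_X₃ (e + 2) h3 (hasProjectiveDimensionLT_of_ge _ 2 _ (by lia))

/-- Finite global dimension lifts along the quotient by a regular element of the maximal ideal. -/
lemma hasProjectiveDimensionLT_succ_of_quotient [IsNoetherianRing S] [IsLocalRing S]
    (hx : x ∈ nonZeroDivisors S) (hm : x ∈ IsLocalRing.maximalIdeal S) (d : ℕ)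
    (h : ∀ (L : Type u) [AddCommGroup L] [Module (S ⧸ Ideal.span {x}) L]
      [Module.Finite (S ⧸ Ideal.span {x}) L],
      HasProjectiveDimensionLT (ModuleCat.of (S ⧸ Ideal.span {x}) L) (d + 1))
    (N : Type u) [AddCommGroup N] [Module S N] [Module.Finite S N] :
    HasProjectiveDimensionLT (ModuleCat.of S N) (d + 2) := by
  obtain ⟨n, g, hg⟩ := Module.Finite.exists_fin' S N
  have h1 := shortExact_of_linearMap (f := g.ker.subtype) (g := g) Subtype.val_injective hg
    (LinearMap.exact_subtype_ker_map g)
  have hP : Projective (ModuleCat.of S (Fin n → S)) :=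
    (IsProjective.iff_projective (R := S) (Fin n → S)).mp inferInstance
  -- The module `N` may have `x`-torsion; its syzygy lies in a free module, so `x` is regular on it.
  refine (h1.hasProjectiveDimensionLT_X₃_iff d hP).mpr ?_
  have hreg : IsSMulRegular (ModuleCat.of S g.ker) x := by
    intro y z hyz
    ext i
    have := congrFun (congrArg Subtype.val hyz) i
    exact (mul_cancel_left_mem_nonZeroDivisors hx).mp this
  -- For the syzygy `Z`, `pd Z + 1 = pd (Z/xZ)` over `S`, and change of rings bounds the latter by
  -- `d + 1`.
  have hpd := ModuleCat.projectiveDimension_quotSMulTop_eq_succ_of_isSMulRegular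
    (ModuleCat.of S g.ker) x hreg hm
  have : Module.Finite (S ⧸ Ideal.span {x}) (QuotSMulTop x g.ker) :=
    Module.Finite.of_restrictScalars_finite S _ _
  have h2 := hasProjectiveDimensionLT_of_quotient x hx d (QuotSMulTop x g.ker) (h _)
  have h3 : projectiveDimension (ModuleCat.of S (QuotSMulTop x g.ker)) ≤ (d + 1 : ℕ) :=
    (projectiveDimension_le_iff _ _).mpr h2
  rw [hpd] at h3
  refine (projectiveDimension_le_iff _ d).mp ?_
  rwa [Nat.cast_add, Nat.cast_one, ← Nat.cast_one (R := WithBot ℕ∞),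
    ENat.WithBot.add_le_add_natCast_right_iff] at h3

end ChangeOfRings

/-! ### Regular local rings: domains of finite global dimension. -/

section RegularLocal

open IsLocalRing

variable {A : Type u} [CommRing A]

/-- The class of `x` in the cotangent space is nonzero, hence part of a basis; by Nakayama, lifts of
a basis generate the maximal ideal. -/
lemma exists_maximalIdeal_eq_span_insert [IsLocalRing A] [IsNoetherianRing A] {x : A}
    (hx : x ∈ maximalIdeal A) (hx2 : x ∉ maximalIdeal A ^ 2) :
    ∃ T : Set A, T.Finite ∧ T.ncard + 1 = (maximalIdeal A).spanFinrank ∧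
      maximalIdeal A = Ideal.span (insert x T) := by
  classical
  let v : CotangentSpace A := (maximalIdeal A).toCotangent ⟨x, hx⟩
  have hv : v ≠ 0 := fun h ↦ hx2 ((Ideal.toCotangent_eq_zero _ _).mp h)
  have hli : LinearIndepOn (ResidueField A) id {v} := LinearIndepOn.singleton hv
  let b : Set (CotangentSpace A) := hli.extend (Set.subset_univ _)
  let B : Module.Basis b (ResidueField A) (CotangentSpace A) := Module.Basis.extend hli
  have hvb : v ∈ b := hli.subset_extend _ rfl
  have hbfin : b.Finite := Module.Finite.finite_basis B
  have hspan : Submodule.span (ResidueField A) b = ⊤ := by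
    rw [← B.span_eq, Module.Basis.range_extend]
  -- An arbitrary lifting, altered at `v` so that `x` itself is the chosen lift.
  let g : CotangentSpace A → maximalIdeal A := Function.update
    (Function.surjInv (maximalIdeal A).toCotangent_surjective) v ⟨x, hx⟩
  have hg (y : CotangentSpace A) : (maximalIdeal A).toCotangent (g y) = y := by
    by_cases h : y = v
    · subst h
      simp only [g, Function.update_self]
      rfl
    · simp only [g, Function.update_of_ne h]
      exact Function.surjInv_eq _ _
  have hgspan : Submodule.span A (g '' b) = ⊤ := by
    rw [← CotangentSpace.span_image_eq_top_iff, ← hspan, ← Set.image_comp]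
    congr 1
    ext y
    simp [hg]
  refine ⟨(fun y ↦ (g y : A)) '' (b \ {v}), (hbfin.subset Set.sdiff_subset).image _, ?_, ?_⟩
  · rw [Set.InjOn.ncard_image, Set.ncard_sdiff_singleton_add_one hvb hbfin,
      spanFinrank_maximalIdeal_eq_finrank_cotangentSpace, Module.finrank_eq_nat_card_basis B]
    · rfl
    · intro y _ z _ h
      rw [← hg y, ← hg z, Subtype.ext h]
  · have h1 : (maximalIdeal A) = Ideal.span ((fun y ↦ (g y : A)) '' b) := by
      have := congrArg (Submodule.map (maximalIdeal A).subtype) hgspan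
      rw [Submodule.map_span, Submodule.map_top, Submodule.range_subtype, ← Set.image_comp] at this
      exact this.symm
    have h2 : insert v (b \ {v}) = b := by
      rw [Set.insert_sdiff_singleton, Set.insert_eq_of_mem hvb]
    have h3 : (g v : A) = x := by simp [g]
    conv_lhs => rw [h1, ← h2, Set.image_insert_eq, h3]

lemma isLocalRing_quotient_span_singleton [IsLocalRing A] {x : A} (hx : x ∈ maximalIdeal A) :
    IsLocalRing (A ⧸ Ideal.span {x}) := by
  have : Nontrivial (A ⧸ Ideal.span {x}) := Ideal.Quotient.nontrivial_iff.mpr fun h ↦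
    (maximalIdeal.isMaximal A).ne_top (eq_top_iff.mpr
      (h ▸ (Ideal.span_singleton_le_iff_mem _).mpr hx))
  exact IsLocalRing.of_surjective' _ Ideal.Quotient.mk_surjective

/-- The quotient of a regular local ring by a regular parameter is regular local. -/
lemma isRegularLocalRing_quotient [IsRegularLocalRing A] {d : ℕ}
    (hd : ringKrullDim A = (d + 1 : ℕ)) {x : A}
    (hx : x ∈ maximalIdeal A) (hx2 : x ∉ maximalIdeal A ^ 2) :
    IsRegularLocalRing (A ⧸ Ideal.span {x}) ∧ ringKrullDim (A ⧸ Ideal.span {x}) = d := by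
  have := isLocalRing_quotient_span_singleton hx
  obtain ⟨T, hT, hcard, hspan⟩ := exists_maximalIdeal_eq_span_insert hx hx2
  have hTd : T.ncard = d := by
    have h := IsRegularLocalRing.spanFinrank_maximalIdeal (R := A)
    rw [hd, ← hcard] at h
    exact Nat.succ_injective (by exact_mod_cast h)
  have hm : maximalIdeal (A ⧸ Ideal.span {x}) =
      Ideal.span (Ideal.Quotient.mk (Ideal.span {x}) '' T) := by
    have h0 : Ideal.Quotient.mk (Ideal.span {x}) x = 0 :=
      Ideal.Quotient.eq_zero_iff_mem.mpr (Ideal.mem_span_singleton_self x)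
    have : maximalIdeal (A ⧸ Ideal.span {x}) =
        (maximalIdeal A).map (Ideal.Quotient.mk (Ideal.span {x})) := by
      have : (maximalIdeal (A ⧸ Ideal.span {x})).comap (Ideal.Quotient.mk (Ideal.span {x})) =
          maximalIdeal A := by
        have := IsLocalHom.of_surjective (Ideal.Quotient.mk (Ideal.span {x}))
          Ideal.Quotient.mk_surjective
        exact IsLocalRing.maximalIdeal_comap _
      rw [← this, Ideal.map_comap_of_surjective _ Ideal.Quotient.mk_surjective]
    rw [this, hspan, Ideal.map_span, Set.image_insert_eq, h0, Ideal.span_insert_zero]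
  have hle : (maximalIdeal (A ⧸ Ideal.span {x})).spanFinrank ≤ d := by
    rw [hm, ← hTd]
    exact (Submodule.spanFinrank_span_le_ncard_of_finite (hT.image _)).trans (Set.ncard_image_le hT)
  -- Killing one element lowers the dimension by at most one, while `d` generators remain; the two
  -- bounds force regularity.
  have hdim : (d : WithBot ℕ∞) ≤ ringKrullDim (A ⧸ Ideal.span {x}) := by
    have h := ringKrullDim_le_ringKrullDim_quotient_add_card (R := A) {x} (by
      rw [IsLocalRing.ringJacobson_eq_maximalIdeal]
      simpa using hx)
    rw [hd, Finset.coe_singleton, Finset.card_singleton, Nat.cast_add,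
      ENat.WithBot.add_le_add_natCast_right_iff] at h
    exact h
  have hreg := IsRegularLocalRing.of_spanFinrank_maximalIdeal_le (A ⧸ Ideal.span {x})
    (le_trans (by exact_mod_cast hle) hdim)
  refine ⟨hreg, le_antisymm ?_ hdim⟩
  rw [← hreg.spanFinrank_maximalIdeal]
  exact_mod_cast hle

lemma isField_of_isRegularLocalRing [IsRegularLocalRing A] (h : ringKrullDim A = 0) :
    IsField A := by
  rw [IsLocalRing.isField_iff_maximalIdeal_eq]
  have h1 := IsRegularLocalRing.spanFinrank_maximalIdeal (R := A)
  rw [h] at h1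
  have h2 : (maximalIdeal A).spanFinrank = 0 := by exact_mod_cast h1
  exact (Submodule.spanFinrank_eq_zero_iff_eq_bot (maximalIdeal A).fg_of_isNoetherianRing).mp h2

lemma maximalIdeal_not_le_sq [IsLocalRing A] [IsNoetherianRing A] (h : ¬ IsField A) :
    ¬ maximalIdeal A ≤ maximalIdeal A ^ 2 := by
  intro hle
  refine h ((IsLocalRing.isField_iff_maximalIdeal_eq).mpr ?_)
  refine Submodule.eq_bot_of_le_smul_of_le_jacobson_bot (maximalIdeal A) (maximalIdeal A)
    (maximalIdeal A).fg_of_isNoetherianRing ?_ (IsLocalRing.jacobson_eq_maximalIdeal _ bot_ne_top).ge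
  rwa [smul_eq_mul, ← pow_two]

/-- A regular local ring is a domain. -/
theorem isDomain_of_isRegularLocalRing (d : ℕ) (A : Type u) [CommRing A] [IsRegularLocalRing A]
    (hd : ringKrullDim A = d) : IsDomain A := by
  induction d generalizing A with
  | zero => exact (isField_of_isRegularLocalRing (by simpa using hd)).isDomain
  | succ d ih =>
    have hfield : ¬ IsField A := fun h ↦ by
      rw [ringKrullDim_eq_zero_of_isField h] at hd
      exact absurd hd (by norm_cast)
    have hfin := minimalPrimes.finite_of_isNoetherianRing A
    -- Prime avoidance, which tolerates two ideals that need not be prime; both are taken to be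
    -- `maximalIdeal A ^ 2`.
    have hex : ∃ x ∈ maximalIdeal A, x ∉ maximalIdeal A ^ 2 ∧ ∀ p ∈ minimalPrimes A, x ∉ p := by
      by_contra! hcon
      have := (Ideal.subset_union_prime' (s := hfin.toFinset) (f := id) (a := maximalIdeal A ^ 2)
        (b := maximalIdeal A ^ 2) (I := maximalIdeal A) fun p hp ↦
          (hfin.mem_toFinset.mp hp).isPrime).mp fun x hx ↦ by
            by_cases h : x ∈ maximalIdeal A ^ 2
            · exact Or.inl (Or.inl h)
            · obtain ⟨p, hp, hxp⟩ := hcon x hx h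
              exact Or.inr (Set.mem_biUnion (by simpa using hp) hxp)
      obtain h | h | ⟨p, hp, h⟩ := this
      · exact maximalIdeal_not_le_sq hfield h
      · exact maximalIdeal_not_le_sq hfield h
      · replace hp := hfin.mem_toFinset.mp hp
        have hpp := Ideal.IsMinimalPrime.isPrime hp
        have hpm : p = maximalIdeal A := le_antisymm (IsLocalRing.le_maximalIdeal hpp.ne_top) h
        have h0 : ringKrullDim A = 0 := by
          rw [← maximalIdeal_height_eq_ringKrullDim, ← hpm]
          rw [Ideal.height_eq_zero_iff.mpr hp]
          rfl
        rw [h0] at hd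
        exact absurd hd (by norm_cast)
    obtain ⟨x, hx, hx2, hxp⟩ := hex
    obtain ⟨hreg, hdim⟩ := isRegularLocalRing_quotient hd hx hx2
    have hdom := ih _ hdim
    have hprime : (Ideal.span {x}).IsPrime := (Ideal.Quotient.isDomain_iff_prime _).mp hdom
    obtain ⟨p, hp, hpx⟩ := Ideal.exists_minimalPrimes_le (I := (⊥ : Ideal A)) (J := Ideal.span {x})
      bot_le
    have hpp := Ideal.IsMinimalPrime.isPrime hp
    -- As `p ⊆ (x)` and `x ∉ p`, every element of `p` is `x` times an element of `p`; Nakayama gives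
    -- `p = 0`.
    have hp0 : p = ⊥ := by
      refine Submodule.eq_bot_of_le_smul_of_le_jacobson_bot (maximalIdeal A) p
        p.fg_of_isNoetherianRing (fun y hy ↦ ?_)
        (IsLocalRing.jacobson_eq_maximalIdeal _ bot_ne_top).ge
      obtain ⟨z, rfl⟩ := Ideal.mem_span_singleton'.mp (hpx hy)
      rw [mul_comm]
      exact Ideal.mul_mem_mul hx ((hpp.mem_or_mem hy).resolve_right (hxp p hp))
    rw [hp0] at hpp
    exact IsDomain.of_bot_isPrime A

/-- A regular local ring of dimension `d` has global dimension at most `d`. -/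
theorem hasProjectiveDimensionLT_of_isRegularLocalRing (d : ℕ) (A : Type u) [CommRing A]
    [IsRegularLocalRing A] (hd : ringKrullDim A = d) (N : Type u) [AddCommGroup N] [Module A N]
    [Module.Finite A N] : HasProjectiveDimensionLT (ModuleCat.of A N) (d + 1) := by
  induction d generalizing A N with
  | zero =>
    let := (isField_of_isRegularLocalRing (A := A) (by simpa using hd)).toField
    rw [zero_add, ← projective_iff_hasProjectiveDimensionLT_one]
    exact (IsProjective.iff_projective (R := A) N).mp inferInstance
  | succ d ih =>
    have hfield : ¬ IsField A := fun h ↦ by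
      rw [ringKrullDim_eq_zero_of_isField h] at hd
      exact absurd hd (by norm_cast)
    obtain ⟨x, hx, hx2⟩ := SetLike.not_le_iff_exists.mp (maximalIdeal_not_le_sq hfield)
    obtain ⟨hreg, hdim⟩ := isRegularLocalRing_quotient hd hx hx2
    have := isDomain_of_isRegularLocalRing _ A hd
    have hx0 : x ≠ 0 := fun h ↦ hx2 (h ▸ zero_mem _)
    exact hasProjectiveDimensionLT_succ_of_quotient x (mem_nonZeroDivisors_of_ne_zero hx0) hx d
      (fun L _ _ _ ↦ ih _ hdim L) N

lemma hasProjectiveDimensionLT_of_isRegularLocalRing_of_le (d : ℕ) (A : Type u) [CommRing A]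
    [IsRegularLocalRing A] (hd : ringKrullDim A ≤ d) (N : Type u) [AddCommGroup N] [Module A N]
    [Module.Finite A N] : HasProjectiveDimensionLT (ModuleCat.of A N) (d + 1) := by
  have h := IsRegularLocalRing.spanFinrank_maximalIdeal (R := A)
  have := hasProjectiveDimensionLT_of_isRegularLocalRing _ A h.symm N
  rw [← h] at hd
  exact hasProjectiveDimensionLT_of_ge _ _ _ (Nat.succ_le_succ (by exact_mod_cast hd))

/-- A regular ring of dimension at most `d` has global dimension at most `d`. -/
theorem hasProjectiveDimensionLT_of_isRegularRing (d : ℕ) (A : Type u) [CommRing A]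
    [IsRegularRing A] (hd : ringKrullDim A ≤ d) (N : ModuleCat.{u} A) [Module.Finite A N] :
    HasProjectiveDimensionLT N (d + 1) := by
  -- The bound is local at maximal ideals, where the dimension is the height of `m`.
  refine (N.hasProjectiveDimensionLE_iff_forall_maximalSpectrum d).mpr fun m ↦ ?_
  have : Module.Finite (Localization.AtPrime m.asIdeal) (N.localizedModule m.asIdeal.primeCompl) :=
    Module.Finite.of_isLocalizedModule m.asIdeal.primeCompl
      (N.localizedModuleMkLinearMap m.asIdeal.primeCompl)
  refine hasProjectiveDimensionLT_of_isRegularLocalRing_of_le d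
    (Localization.AtPrime m.asIdeal) (le_trans ?_ hd) (N.localizedModule m.asIdeal.primeCompl)
  rw [IsLocalization.AtPrime.ringKrullDim_eq_height m.asIdeal]
  exact Ideal.height_le_ringKrullDim_of_ne_top m.isMaximal.ne_top

end RegularLocal

/-! ### Minimal primes of monomial ideals. -/

section MonomialIdeals

/-- The minimal primes of a monomial ideal are generated by variables. -/
lemma eq_span_of_mem_minimalPrimes {P : Type*} [CommRing P] {r s : ℕ} (X : Fin r → P)
    (e : Fin s → Fin r →₀ ℕ) (m : Fin s → P) (hm : ∀ j, m j = ∏ i, X i ^ e j i)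
    (hX : ∀ S : Set (Fin r), (Ideal.span (X '' S)).IsPrime) (q : Ideal P)
    (hq : q ∈ (Ideal.span (Set.range m)).minimalPrimes) :
    ∃ S : Set (Fin r), q = Ideal.span (X '' S) := by
  have hqp := hq.isPrime
  refine ⟨{i | X i ∈ q}, ?_⟩
  have hle : Ideal.span (X '' {i | X i ∈ q}) ≤ q := Ideal.span_le.mpr (by
    rintro _ ⟨i, hi, rfl⟩
    exact hi)
  -- By minimality of `q`, it suffices that the variables in `q` generate a prime containing all the
  -- monomials.
  refine le_antisymm (hq.2 ⟨hX _, Ideal.span_le.mpr ?_⟩ hle) hle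
  rintro _ ⟨j, rfl⟩
  have hj : m j ∈ q := hq.1.2 (Ideal.subset_span ⟨j, rfl⟩)
  rw [hm] at hj ⊢
  obtain ⟨i, -, hi⟩ := (Ideal.IsPrime.prod_mem_iff (s := Finset.univ)).mp hj
  have hXi := hqp.mem_of_pow_mem _ hi
  have hne : e j i ≠ 0 := fun h ↦
    hqp.ne_top ((Ideal.eq_top_iff_one q).mpr (by simpa [h] using hi))
  exact Ideal.mem_of_dvd _ ((dvd_pow_self _ hne).trans
    (Finset.dvd_prod_of_mem _ (Finset.mem_univ i)))
    (Ideal.subset_span ⟨i, hXi, rfl⟩)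

/-- A component of a quotient ring is a quotient by a minimal prime over the ideal. -/
lemma exists_minimalPrimes_quotient_equiv {P : Type u} [CommRing P] (I : Ideal P)
    (p : Ideal (P ⧸ I)) (hp : p ∈ minimalPrimes (P ⧸ I)) :
    ∃ q ∈ I.minimalPrimes, Nonempty (P ⧸ q ≃+* (P ⧸ I) ⧸ p) := by
  refine ⟨p.comap (Ideal.Quotient.mk I), ?_, ⟨?_⟩⟩
  · rw [Ideal.minimalPrimes_eq_comap]
    exact ⟨p, hp, rfl⟩
  · refine (Ideal.quotEquivOfEq ?_).trans (RingHom.quotientKerEquivOfSurjective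
      (f := (Ideal.Quotient.mk p).comp (Ideal.Quotient.mk I))
      (Ideal.Quotient.mk_surjective.comp Ideal.Quotient.mk_surjective))
    rw [← RingHom.comap_ker, Ideal.mk_ker]

end MonomialIdeals

/-! ### Components of polynomial type. -/

section Polynomial

variable (k : Type u) [Field k] {r : ℕ}

lemma nonempty_quotient_span_X_equiv (S : Set (Fin r)) :
    Nonempty (MvPolynomial (Fin r) k ⧸
        Ideal.span ((MvPolynomial.X : Fin r → MvPolynomial (Fin r) k) '' S) ≃+*
      MvPolynomial (Sᶜ : Set (Fin r)) k) := by
  classical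
  let φ : MvPolynomial (Fin r) k →ₐ[k] MvPolynomial (Sᶜ : Set (Fin r)) k :=
    MvPolynomial.aeval fun i ↦ if h : i ∈ S then 0 else MvPolynomial.X ⟨i, h⟩
  let ψ : MvPolynomial (Sᶜ : Set (Fin r)) k →ₐ[k] MvPolynomial (Fin r) k :=
    MvPolynomial.rename Subtype.val
  have hφψ : φ.comp ψ = AlgHom.id k _ := by
    ext ⟨i, hi⟩ : 1
    have : i ∉ S := hi
    simp [φ, ψ, this]
  let π := Ideal.Quotient.mkₐ k
    (Ideal.span ((MvPolynomial.X : Fin r → MvPolynomial (Fin r) k) '' S))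
  -- Modulo the variables in `S`, `ψ` inverts `φ`; so the kernel of `φ` is no larger than their
  -- span.
  have hψφ : (π.comp ψ).comp φ = π := by
    ext i : 1
    by_cases h : i ∈ S
    · have : π (MvPolynomial.X i) = 0 :=
        Ideal.Quotient.eq_zero_iff_mem.mpr (Ideal.subset_span ⟨i, h, rfl⟩)
      rw [this]
      simp [φ, h]
    · simp [φ, ψ, h]
  have hker : Ideal.span ((MvPolynomial.X : Fin r → MvPolynomial (Fin r) k) '' S) =
      RingHom.ker φ.toRingHom := by
    refine le_antisymm (Ideal.span_le.mpr ?_) fun f hf ↦ ?_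
    · rintro _ ⟨i, hi, rfl⟩
      simp [φ, hi]
    · refine Ideal.Quotient.eq_zero_iff_mem.mp ?_
      have h1 : φ f = 0 := hf
      have h2 := AlgHom.congr_fun hψφ f
      rw [AlgHom.comp_apply, h1, map_zero] at h2
      exact h2.symm
  exact ⟨(Ideal.quotEquivOfEq hker).trans (RingHom.quotientKerEquivOfSurjective
    (f := φ.toRingHom) fun f ↦ ⟨ψ f, AlgHom.congr_fun hφψ f⟩)⟩

lemma isPrime_span_X_mvPolynomial (S : Set (Fin r)) :
    (Ideal.span ((MvPolynomial.X : Fin r → MvPolynomial (Fin r) k) '' S)).IsPrime := by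
  obtain ⟨E⟩ := nonempty_quotient_span_X_equiv k S
  have : IsDomain (MvPolynomial (Fin r) k ⧸
    Ideal.span ((MvPolynomial.X : Fin r → MvPolynomial (Fin r) k) '' S)) :=
    MulEquiv.isDomain _ E.toMulEquiv
  exact (Ideal.Quotient.isDomain_iff_prime _).mp this

end Polynomial

/-! ### Components of power series type. -/

section PowerSeries

variable (k : Type u) [Field k]

lemma natCast_le_ringKrullDim_mvPowerSeries (r : ℕ) :
    (r : WithBot ℕ∞) ≤ ringKrullDim (MvPowerSeries (Fin r) k) := by
  induction r with
  | zero => exact ringKrullDim_nonneg_of_nontrivial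
  | succ r ih =>
    rw [ringKrullDim_eq_of_ringEquiv (MvPowerSeries.finSuccEquiv k r).toRingEquiv, Nat.cast_add,
      Nat.cast_one]
    exact (add_le_add_left ih 1).trans ringKrullDim_succ_le_ringKrullDim_powerseries

/-- Each nonzero exponent is assigned one variable dividing its monomial; `g i` collects the terms
assigned to `i`, divided by `X i`. -/
lemma mem_span_range_X {r : ℕ} (f : MvPowerSeries (Fin r) k)
    (hf : MvPowerSeries.constantCoeff f = 0) :
    f ∈ Ideal.span (Set.range (MvPowerSeries.X : Fin r → MvPowerSeries (Fin r) k)) := by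
  classical
  have hex (n : Fin r →₀ ℕ) : ∃ i : Option (Fin r), (n ≠ 0 → ∃ j, i = some j ∧ n j ≠ 0) := by
    by_cases hn : n = 0
    · exact ⟨none, fun h ↦ (h hn).elim⟩
    · obtain ⟨j, hj⟩ := Finsupp.ne_iff.mp hn
      exact ⟨some j, fun _ ↦ ⟨j, rfl, hj⟩⟩
  choose c hc using hex
  let g (i : Fin r) : MvPowerSeries (Fin r) k := fun n ↦
    if c (n + Finsupp.single i 1) = some i then MvPowerSeries.coeff (n + Finsupp.single i 1) f else 0
  have hfg : f = ∑ i, g i * MvPowerSeries.X i := by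
    ext n
    by_cases hn : n = 0
    · subst hn
      rw [MvPowerSeries.coeff_zero_eq_constantCoeff, hf, map_sum]
      simp
    · obtain ⟨j, hj, hnj⟩ := hc n hn
      have hle (i : Fin r) : Finsupp.single i 1 ≤ n ↔ n i ≠ 0 := by
        rw [Finsupp.single_le_iff]
        lia
      rw [map_sum, Finset.sum_eq_single j]
      · rw [MvPowerSeries.X, MvPowerSeries.coeff_mul_monomial, if_pos ((hle j).mpr hnj), mul_one]
        change _ = if _ then _ else _
        rw [tsub_add_cancel_of_le ((hle j).mpr hnj), if_pos hj]
      · intro i _ hij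
        rw [MvPowerSeries.X, MvPowerSeries.coeff_mul_monomial]
        split_ifs with h
        · rw [mul_one]
          change (if _ then _ else _) = _
          rw [tsub_add_cancel_of_le h, hj, if_neg]
          simpa using hij.symm
        · rfl
      · simp
  rw [hfg]
  exact Ideal.sum_mem _ fun i _ ↦ Ideal.mul_mem_left _ _ (Ideal.subset_span ⟨i, rfl⟩)

-- The variables outside `S` generate the maximal ideal. Conversely `r ≤ dim k[[X]] ≤ dim (k[[X]]/I)
-- + |S|`, so the dimension is at least their number.
open IsLocalRing in
lemma isRegularLocalRing_quotient_span_X {r : ℕ} (S : Set (Fin r)) :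
    IsRegularLocalRing (MvPowerSeries (Fin r) k ⧸
      Ideal.span ((MvPowerSeries.X : Fin r → MvPowerSeries (Fin r) k) '' S)) := by
  classical
  set I := Ideal.span ((MvPowerSeries.X : Fin r → MvPowerSeries (Fin r) k) '' S)
  have hX (i : Fin r) : (MvPowerSeries.X i : MvPowerSeries (Fin r) k) ∈ maximalIdeal _ := by
    rw [mem_maximalIdeal, mem_nonunits_iff, MvPowerSeries.isUnit_iff_constantCoeff]
    simp
  have hm : maximalIdeal (MvPowerSeries (Fin r) k) =
      Ideal.span (Set.range (MvPowerSeries.X : Fin r → MvPowerSeries (Fin r) k)) := by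
    refine le_antisymm (fun f hf ↦ mem_span_range_X k f ?_) (Ideal.span_le.mpr ?_)
    · rw [mem_maximalIdeal, mem_nonunits_iff, MvPowerSeries.isUnit_iff_constantCoeff] at hf
      simpa using hf
    · rintro _ ⟨i, rfl⟩
      exact hX i
  have hI : I ≤ maximalIdeal _ := Ideal.span_le.mpr (by
    rintro _ ⟨i, -, rfl⟩
    exact hX i)
  have : Nontrivial (MvPowerSeries (Fin r) k ⧸ I) := Ideal.Quotient.nontrivial_iff.mpr fun h ↦
    (maximalIdeal.isMaximal _).ne_top (eq_top_iff.mpr (h ▸ hI))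
  have : IsLocalRing (MvPowerSeries (Fin r) k ⧸ I) :=
    IsLocalRing.of_surjective' _ Ideal.Quotient.mk_surjective
  have hmI : maximalIdeal (MvPowerSeries (Fin r) k ⧸ I) =
      Ideal.span ((fun i ↦ Ideal.Quotient.mk I (MvPowerSeries.X i)) '' Sᶜ) := by
    rw [← IsLocalRing.map_maximalIdeal_of_surjective (Ideal.Quotient.mk I)
      Ideal.Quotient.mk_surjective, hm, Ideal.map_span]
    refine le_antisymm (Ideal.span_le.mpr ?_) (Ideal.span_mono ?_)
    · rintro _ ⟨_, ⟨i, rfl⟩, rfl⟩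
      by_cases hi : i ∈ S
      · have hiI : MvPowerSeries.X i ∈ I := Ideal.subset_span ⟨i, hi, rfl⟩
        rw [Ideal.Quotient.eq_zero_iff_mem.mpr hiI]
        exact zero_mem _
      · exact Ideal.subset_span ⟨i, hi, rfl⟩
    · rintro _ ⟨i, -, rfl⟩
      exact ⟨_, ⟨i, rfl⟩, rfl⟩
  have hcard : S.ncard + (Sᶜ).ncard = r := by
    rw [Set.ncard_add_ncard_compl, Nat.card_fin]
  refine IsRegularLocalRing.of_spanFinrank_maximalIdeal_le _ ?_
  have h1 : (maximalIdeal (MvPowerSeries (Fin r) k ⧸ I)).spanFinrank ≤ (Sᶜ).ncard := by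
    rw [hmI]
    exact (Submodule.spanFinrank_span_le_ncard_of_finite ((Set.toFinite _).image _)).trans
      (Set.ncard_image_le)
  have h2 := (natCast_le_ringKrullDim_mvPowerSeries k r).trans
    (ringKrullDim_le_ringKrullDim_quotient_add_spanFinrank I (by
      rwa [IsLocalRing.ringJacobson_eq_maximalIdeal]))
  have h3 : I.spanFinrank ≤ S.ncard :=
    (Submodule.spanFinrank_span_le_ncard_of_finite ((Set.toFinite _).image _)).trans
      (Set.ncard_image_le)
  have h4 : (((Sᶜ).ncard + S.ncard : ℕ) : WithBot ℕ∞) ≤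
      ringKrullDim (MvPowerSeries (Fin r) k ⧸ I) + (S.ncard : ℕ) := by
    rw [add_comm, hcard]
    exact h2.trans (add_le_add_right (by exact_mod_cast h3) _)
  rw [Nat.cast_add, ENat.WithBot.add_le_add_natCast_right_iff] at h4
  exact le_trans (by exact_mod_cast h1) h4

/-- The quotient is regular local, hence a domain; it need not be identified with a smaller power
series ring. -/
lemma isPrime_span_X_mvPowerSeries {r : ℕ} (S : Set (Fin r)) :
    (Ideal.span ((MvPowerSeries.X : Fin r → MvPowerSeries (Fin r) k) '' S)).IsPrime := by
  have := isRegularLocalRing_quotient_span_X k S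
  exact (Ideal.Quotient.isDomain_iff_prime _).mp (isDomain_of_isRegularLocalRing _ _
    (IsRegularLocalRing.spanFinrank_maximalIdeal).symm)

end PowerSeries

/-! ### Components of monomial quotients are regular of finite dimension. -/

section Components

lemma exists_ringKrullDim_eq_natCast (A : Type*) [CommRing A] [IsRegularLocalRing A] :
    ∃ d : ℕ, ringKrullDim A = d :=
  ⟨_, IsRegularLocalRing.spanFinrank_maximalIdeal.symm⟩

variable (k : Type u) [Field k] {r s : ℕ} (e : Fin s → Fin r →₀ ℕ)

lemma finite_projectiveDimension_of_mem_minimalPrimes_monomialQuotient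
    (p : Ideal (MonomialQuotient k e)) (hp : p ∈ minimalPrimes (MonomialQuotient k e)) :
    ∃ d : ℕ, ringKrullDim (MonomialQuotient k e ⧸ p) = d ∧
      ∀ N : ModuleCat.{u} (MonomialQuotient k e ⧸ p), Module.Finite (MonomialQuotient k e ⧸ p) N →
        HasProjectiveDimensionLT N (d + 1) := by
  obtain ⟨q, hq, ⟨E⟩⟩ := exists_minimalPrimes_quotient_equiv _ p hp
  obtain ⟨S, rfl⟩ := eq_span_of_mem_minimalPrimes
    (MvPolynomial.X : Fin r → MvPolynomial (Fin r) k) e _ (fun j ↦ by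
      rw [MvPolynomial.monomial_eq, map_one, one_mul, Finsupp.prod_fintype _ _ (by simp)])
    (isPrime_span_X_mvPolynomial k) q hq
  obtain ⟨E'⟩ := nonempty_quotient_span_X_equiv k S
  have hd : ringKrullDim (MonomialQuotient k e ⧸ p) = (Nat.card (Sᶜ : Set (Fin r)) : ℕ) := by
    rw [← ringKrullDim_eq_of_ringEquiv E, ringKrullDim_eq_of_ringEquiv E',
      MvPolynomial.ringKrullDim_of_isNoetherianRing, ringKrullDim_eq_zero_of_field, zero_add]
  have := IsRegularRing.of_ringEquiv E'.symm
  have := IsRegularRing.of_ringEquiv (R' := MonomialQuotient k e ⧸ p) E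
  exact ⟨_, hd, fun N _ ↦ hasProjectiveDimensionLT_of_isRegularRing _
    (MonomialQuotient k e ⧸ p) hd.le N⟩

lemma finite_projectiveDimension_of_mem_minimalPrimes_powerSeriesMonomialQuotient
    (p : Ideal (PowerSeriesMonomialQuotient k e))
    (hp : p ∈ minimalPrimes (PowerSeriesMonomialQuotient k e)) :
    ∃ d : ℕ, ringKrullDim (PowerSeriesMonomialQuotient k e ⧸ p) = d ∧
      ∀ N : ModuleCat.{u} (PowerSeriesMonomialQuotient k e ⧸ p),
        Module.Finite (PowerSeriesMonomialQuotient k e ⧸ p) N →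
          HasProjectiveDimensionLT N (d + 1) := by
  obtain ⟨q, hq, ⟨E⟩⟩ := exists_minimalPrimes_quotient_equiv _ p hp
  obtain ⟨S, rfl⟩ := eq_span_of_mem_minimalPrimes
    (MvPowerSeries.X : Fin r → MvPowerSeries (Fin r) k) e _ (fun j ↦ by
      rw [MvPowerSeries.monomial_one_eq, Finsupp.prod_fintype _ _ (by simp)])
    (isPrime_span_X_mvPowerSeries k) q hq
  have := isRegularLocalRing_quotient_span_X k S
  have := IsRegularLocalRing.of_ringEquiv (R' := PowerSeriesMonomialQuotient k e ⧸ p) E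
  obtain ⟨d, hd⟩ := exists_ringKrullDim_eq_natCast (PowerSeriesMonomialQuotient k e ⧸ p)
  exact ⟨d, hd, fun N _ ↦ hasProjectiveDimensionLT_of_isRegularLocalRing _
    (PowerSeriesMonomialQuotient k e ⧸ p) hd N⟩

end Components

end TriangulatedDimension

end

theorem mainTheorem10 (k : Type u) [Field k] (r s : ℕ) (e : Fin s → Fin r →₀ ℕ)
    [HasDerivedCategory.{w} (FGModuleCat.{u} (MonomialQuotient k e))]
    [HasDerivedCategory.{w}
      (FGModuleCat.{u} (PowerSeriesMonomialQuotient k e))] :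
    (∃ n : ℕ,
      (n : WithBot ℕ∞) =
        (primeFiltrationLength
          (MonomialQuotient k e) : WithBot ℕ∞) *
        maxDimMinimalPrimes (MonomialQuotient k e) ∧
      generatedIn
        (ObjectProperty.singleton
          (stalk.{w} (MonomialQuotient k e)
            (minimalPrimesModule
              (MonomialQuotient k e)))) n = ⊤ ∧
      triangulatedDim
        (BoundedDerived.{w}
          (MonomialQuotient k e)) ≤ (n : EReal) - 1 ∧
      triangulatedDim
        (BoundedDerived.{w}
          (MonomialQuotient k e)) < ⊤) ∧
    (∃ n : ℕ,
      (n : WithBot ℕ∞) =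
        (primeFiltrationLength
          (PowerSeriesMonomialQuotient k e) : WithBot ℕ∞) *
        maxDimMinimalPrimes
          (PowerSeriesMonomialQuotient k e) ∧
      generatedIn
        (ObjectProperty.singleton
          (stalk.{w} (PowerSeriesMonomialQuotient k e)
            (minimalPrimesModule
              (PowerSeriesMonomialQuotient k e)))) n = ⊤ ∧
      triangulatedDim
        (BoundedDerived.{w}
          (PowerSeriesMonomialQuotient k e)) ≤ (n : EReal) - 1 ∧
      triangulatedDim
        (BoundedDerived.{w}
          (PowerSeriesMonomialQuotient k e)) < ⊤) := by
  exact ⟨generatedIn_stalk_minimalPrimesModule _ fun p hp ↦ by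
      obtain ⟨d, hd, h⟩ :=
        finite_projectiveDimension_of_mem_minimalPrimes_monomialQuotient k e p hp
      exact ⟨d, hd, fun N ↦ h N.obj N.property⟩,
    generatedIn_stalk_minimalPrimesModule _ fun p hp ↦ by
      obtain ⟨d, hd, h⟩ :=
        finite_projectiveDimension_of_mem_minimalPrimes_powerSeriesMonomialQuotient k e p hp
      exact ⟨d, hd, fun N ↦ h N.obj N.property⟩⟩
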